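/- Let $U\subseteq\mathbb C$ be a domain (a non-empty connected open set). Let $\theta$ be a Grassmann variable ($\theta^2=0$), and let $\mathfrak d^1=\mathfrak d^1_0\oplus\mathfrak d^1_1$ be the Lie superalgebra of first-order differential operators acting on functions $a(z)+b(z)\theta$ with $a,b$ analytic on $U$, whose even elements are $f\partial_z+g\,\theta\partial_\theta+h$ and whose odd elements are $\theta\varphi\,\partial_z+\chi\,\partial_\theta+\omega\,\theta$, with coefficients analytic on $U$, and whose bracket is $[A,B]=AB-(-1)^{\deg A\deg B}BA$. For open sets $V,W\subseteq\mathbb C$, two spaces of such operators on $V$ and on $W$ are called equivalent if one is mapped onto the other by a single transformation $T\mapsto u\,T\,u^{-1}$, rewritten in the variables $\bar z=\psi(z)$, $\bar\theta=v(z)\theta$, where $\psi:V\to W$ is biholomorphic and $u,v$ are non-vanishing analytic functions on $V$. Let $\mathfrak s=\mathfrak s_0\oplus\mathfrak s_1$ be a finite-dimensional graded subalgebra of $\mathfrak d^1$ with $\mathfrak s_1\neq 0$. Call $z_0\in U$ regular if either $f\equiv 0$ for all $f\partial_z+g\,\theta\partial_\theta+h\in\mathfrak s_0$, or $f(z_0)\ne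 0$ for at least one of these operators. Then the non-regular points have no accumulation point in $U$, and every regular point $z_0$ has an open neighbourhood $V\subseteq U$ such that the restriction of $\mathfrak s_0$ to $V$ is equivalent to one of the following Lie algebras on some open set $W\subseteq\mathbb C$ (angle brackets denote the complex linear span, $\epsilon\in\{0,1\}$, and $\alpha,\beta,\gamma\in\mathbb C$ are constants): i) $\mathfrak s_0^0=\langle\epsilon\theta\partial_\theta+h_1(z),\ h_l(z)\mid 2\le l\le s\rangle$, where $s\ge 1$, $h_1,\dots,h_s$ are analytic on $W$ and $h_2,\dots,h_s$ are linearly independent; ii) $\mathfrak s_0^1=\langle\partial_z,\ \epsilon\theta\partial_\theta+\alpha z^{s_0+1},\ z^le^{\sigma z}\mid 0\le l\le s_\sigma,\ \sigma\in\Sigma\rangle$, where $\Sigma$ is a finite (possibly empty) set of complex numbers, $s_\sigma\ge 0$ are integers for $\sigma\in\Sigma$, $s_0=-1$ if $0\notin\Sigma$, and $\alpha=0$ if $\epsilon=0$; iii) $\mathfrak s_0^2=\langle\partial_z,\ z\partial_z+\alpha\theta\partial_\theta+\beta,\ \epsilon\theta\partial_\theta+\gamma,\ z^l\mid 0\le l\le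 s\rangle$, where $s\ge -1$ (no power $z^l$ is present if $s=-1$); iv) $\mathfrak s_0^3=\langle\partial_z,\ z\partial_z+\alpha\theta\partial_\theta+\beta,\ z^2\partial_z+2\alpha z\,\theta\partial_\theta+2\beta z,\ \epsilon\theta\partial_\theta+\gamma\rangle$, or the span of this space and the operator $1$. -/

import Mathlib

open TopologicalSpace

namespace SuperDiff

noncomputable section

/-- The algebra of analytic functions on an open set `U` of the complex line. -/
def holSubalgebra (U : Opens ℂ) : Subalgebra ℂ (U → ℂ) where
  carrier := {f | ∃ F : ℂ → ℂ, AnalyticOnNhd ℂ F (U : Set ℂ) ∧ ∀ x : U, f x = F x}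
  mul_mem' := by
    rintro f g ⟨F, hF, hf⟩ ⟨G, hG, hg⟩
    exact ⟨F * G, hF.mul hG, fun x => by simp [hf x, hg x]⟩
  add_mem' := by
    rintro f g ⟨F, hF, hf⟩ ⟨G, hG, hg⟩
    exact ⟨F + G, hF.add hG, fun x => by simp [hf x, hg x]⟩
  algebraMap_mem' := fun c => ⟨fun _ => c, analyticOnNhd_const, fun _ => rfl⟩

/-- The type of analytic functions on `U`. -/
def Hol (U : Opens ℂ) : Type := holSubalgebra U

instance instCommRingHol (U : Opens ℂ) : CommRing (Hol U) :=
  inferInstanceAs (CommRing (holSubalgebra U))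

instance instAlgebraHol (U : Opens ℂ) : Algebra ℂ (Hol U) :=
  inferInstanceAs (Algebra ℂ (holSubalgebra U))

instance instCoeFunHol (U : Opens ℂ) : CoeFun (Hol U) fun _ => U → ℂ := ⟨Subtype.val⟩

theorem Hol.ext {U : Opens ℂ} {f g : Hol U} (h : ∀ x : U, f x = g x) : f = g :=
  Subtype.ext (funext h)

/-- Extension by zero of a function on `U`. -/
def extendZero {U : Opens ℂ} (f : U → ℂ) : ℂ → ℂ := Function.extend Subtype.val f 0

theorem extendZero_apply {U : Opens ℂ} (f : U → ℂ) (x : U) : extendZero f x = f x :=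
  Subtype.val_injective.extend_apply f 0 x

theorem analyticOnNhd_extendZero {U : Opens ℂ} (f : Hol U) :
    AnalyticOnNhd ℂ (extendZero ⇑f) (U : Set ℂ) := by
  obtain ⟨f, F, hF, hf⟩ := f
  refine hF.congr U.isOpen (fun x hx => ?_)
  rw [← hf ⟨x, hx⟩]
  exact (extendZero_apply f ⟨x, hx⟩).symm

theorem extendZero_add {U : Opens ℂ} (f g : U → ℂ) :
    extendZero (f + g) = extendZero f + extendZero g := by
  have := (Function.extend_add (Subtype.val : U → ℂ) f g 0 0)
  simpa [extendZero] using this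

theorem extendZero_smul {U : Opens ℂ} (c : ℂ) (f : U → ℂ) :
    extendZero (c • f) = c • extendZero f := by
  have := (Function.extend_smul c (Subtype.val : U → ℂ) f 0)
  simpa [extendZero] using this

/-- The complex derivative of analytic functions on `U`. -/
def derivHol (U : Opens ℂ) : Hol U →ₗ[ℂ] Hol U where
  toFun f := ⟨fun x => deriv (extendZero ⇑f) x,
    deriv (extendZero ⇑f), (analyticOnNhd_extendZero f).deriv, fun _ => rfl⟩
  map_add' f g := by
    apply Hol.ext
    intro x
    have hf := (analyticOnNhd_extendZero f x x.2).differentiableAt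
    have hg := (analyticOnNhd_extendZero g x x.2).differentiableAt
    change deriv (extendZero (⇑f + ⇑g)) x = _
    rw [extendZero_add]
    exact deriv_add hf hg
  map_smul' c f := by
    apply Hol.ext
    intro x
    have hf := (analyticOnNhd_extendZero f x x.2).differentiableAt
    change deriv (extendZero (c • ⇑f)) x = _
    rw [extendZero_smul]
    exact deriv_const_smul c hf

/-- The coordinate function `z`. -/
def coord (U : Opens ℂ) : Hol U := ⟨fun x => x, id, analyticOnNhd_id, fun _ => rfl⟩

/-- The function `exp (σ z)`. -/
def expFun (U : Opens ℂ) (σ : ℂ) : Hol U :=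
  ⟨fun x => Complex.exp (σ * x), fun z => Complex.exp (σ * z),
    (analyticOnNhd_const.mul analyticOnNhd_id).cexp, fun _ => rfl⟩

/-- Analytic functions on `U` with values in the Grassmann algebra on one generator `θ`:
the pair `(a, b)` stands for `a(z) + b(z) θ`. -/
abbrev SuperFun (U : Opens ℂ) : Type := Hol U × Hol U

/-- Linear operators on the space of Grassmann-valued analytic functions; the product is
composition. -/
abbrev Op (U : Opens ℂ) : Type := Module.End ℂ (SuperFun U)

/-- Multiplication by the analytic function `h`. -/
def mulOp {U : Opens ℂ} (h : Hol U) : Op U :=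
  (LinearMap.mulLeft ℂ h).prodMap (LinearMap.mulLeft ℂ h)

/-- The operator `∂_z`. -/
def dz (U : Opens ℂ) : Op U := (derivHol U).prodMap (derivHol U)

/-- Multiplication by `θ`: `a + b θ ↦ a θ`. -/
def theta (U : Opens ℂ) : Op U :=
  (LinearMap.inr ℂ (Hol U) (Hol U)).comp (LinearMap.fst ℂ (Hol U) (Hol U))

/-- The operator `∂_θ`: `a + b θ ↦ b`. -/
def dtheta (U : Opens ℂ) : Op U :=
  (LinearMap.inl ℂ (Hol U) (Hol U)).comp (LinearMap.snd ℂ (Hol U) (Hol U))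

/-- The even operator `f ∂_z + g θ ∂_θ + h`. -/
def evenOp {U : Opens ℂ} (f g h : Hol U) : Op U :=
  mulOp f * dz U + mulOp g * theta U * dtheta U + mulOp h

/-- The odd operator `θ φ ∂_z + χ ∂_θ + ω θ`. -/
def oddOp {U : Opens ℂ} (φ χ ω : Hol U) : Op U :=
  theta U * mulOp φ * dz U + mulOp χ * dtheta U + mulOp ω * theta U

theorem mulOp_add {U : Opens ℂ} (f g : Hol U) : mulOp (f + g) = mulOp f + mulOp g := by
  apply LinearMap.ext
  rintro ⟨a, b⟩
  simp [mulOp, add_mul]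

theorem mulOp_smul {U : Opens ℂ} (c : ℂ) (f : Hol U) : mulOp (c • f) = c • mulOp f := by
  apply LinearMap.ext
  rintro ⟨a, b⟩
  simp [mulOp]

theorem mulOp_zero {U : Opens ℂ} : mulOp (0 : Hol U) = 0 := by
  simpa using mulOp_smul (0 : ℂ) (0 : Hol U)

/-- The even subspace of the Lie superalgebra of first-order operators on `U`. -/
def evenSpace (U : Opens ℂ) : Submodule ℂ (Op U) where
  carrier := {T | ∃ f g h : Hol U, T = evenOp f g h}
  zero_mem' := ⟨0, 0, 0, by simp [evenOp, mulOp_zero]⟩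
  add_mem' := by
    rintro _ _ ⟨f, g, h, rfl⟩ ⟨f', g', h', rfl⟩
    refine ⟨f + f', g + g', h + h', ?_⟩
    simp only [evenOp, mulOp_add, add_mul]
    abel
  smul_mem' := by
    rintro c _ ⟨f, g, h, rfl⟩
    exact ⟨c • f, c • g, c • h, by simp [evenOp, mulOp_smul]⟩

/-- The odd subspace of the Lie superalgebra of first-order operators on `U`. -/
def oddSpace (U : Opens ℂ) : Submodule ℂ (Op U) where
  carrier := {T | ∃ φ χ ω : Hol U, T = oddOp φ χ ω}
  zero_mem' := ⟨0, 0, 0, by simp [oddOp, mulOp_zero]⟩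
  add_mem' := by
    rintro _ _ ⟨f, g, h, rfl⟩ ⟨f', g', h', rfl⟩
    refine ⟨f + f', g + g', h + h', ?_⟩
    simp only [oddOp, mulOp_add, add_mul, mul_add]
    abel
  smul_mem' := by
    rintro c _ ⟨f, g, h, rfl⟩
    exact ⟨c • f, c • g, c • h, by simp [oddOp, mulOp_smul]⟩

/-- The space `𝔡¹` of first-order operators with coefficients analytic on `U`. -/
def firstOrder (U : Opens ℂ) : Submodule ℂ (Op U) := evenSpace U ⊔ oddSpace U

/-- The even part of a subspace of `𝔡¹`. -/
def evenPart {U : Opens ℂ} (s : Submodule ℂ (Op U)) : Submodule ℂ (Op U) := s ⊓ evenSpace U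

/-- The odd part of a subspace of `𝔡¹`. -/
def oddPart {U : Opens ℂ} (s : Submodule ℂ (Op U)) : Submodule ℂ (Op U) := s ⊓ oddSpace U

/-- `s` is a graded subalgebra of the Lie superalgebra `𝔡¹`: it is a subspace of `𝔡¹` that is
spanned by its even and odd parts and is closed under `[A, B] = AB - (-1)^(deg A deg B) BA`. -/
structure IsGradedSubalgebra {U : Opens ℂ} (s : Submodule ℂ (Op U)) : Prop where
  graded : s = evenPart s ⊔ oddPart s
  even_even : ∀ A ∈ evenPart s, ∀ B ∈ evenPart s, A * B - B * A ∈ s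
  even_odd : ∀ A ∈ evenPart s, ∀ B ∈ oddPart s, A * B - B * A ∈ s
  odd_odd : ∀ A ∈ oddPart s, ∀ B ∈ oddPart s, A * B + B * A ∈ s

/-- Restriction of analytic functions to a smaller open set. -/
def resHol {U V : Opens ℂ} (hVU : V ≤ U) : Hol U →ₗ[ℂ] Hol V where
  toFun f := ⟨fun x => f ⟨x, hVU x.2⟩, by
    obtain ⟨f, F, hF, hf⟩ := f
    exact ⟨F, hF.mono hVU, fun x => hf ⟨x, hVU x.2⟩⟩⟩
  map_add' _ _ := rfl
  map_smul' _ _ := rfl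

/-- Restriction of Grassmann-valued analytic functions to a smaller open set. -/
def resFun {U V : Opens ℂ} (hVU : V ≤ U) : SuperFun U →ₗ[ℂ] SuperFun V :=
  (resHol hVU).prodMap (resHol hVU)

/-- Restriction of a space of first-order operators on `U` to a smaller open set `V`. A first-order
operator on `V` is the restriction of `T` if it is compatible with `T` and the restriction of
functions; it is then the operator whose coefficients are those of `T` restricted to `V`. -/
def restrictOps {U V : Opens ℂ} (hVU : V ≤ U) (L : Submodule ℂ (Op U)) : Submodule ℂ (Op V) where
  carrier := {S | S ∈ firstOrder V ∧ ∃ T ∈ L, S ∘ₗ resFun hVU = resFun hVU ∘ₗ T}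
  zero_mem' := ⟨zero_mem _, 0, zero_mem _, by simp⟩
  add_mem' := by
    rintro S S' ⟨hS, T, hT, h⟩ ⟨hS', T', hT', h'⟩
    exact ⟨add_mem hS hS', T + T', add_mem hT hT', by
      rw [LinearMap.add_comp, LinearMap.comp_add, h, h']⟩
  smul_mem' := by
    rintro c S ⟨hS, T, hT, h⟩
    exact ⟨Submodule.smul_mem _ c hS, c • T, Submodule.smul_mem _ c hT, by
      rw [LinearMap.smul_comp, LinearMap.comp_smul, h]⟩

/-- Composition `f ↦ f ∘ ψ` with an analytic map `ψ : W → V`. -/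
def compHol {V W : Opens ℂ} (ψ : W → V) (hψ : (fun w => (ψ w : ℂ)) ∈ holSubalgebra W) :
    Hol V →ₗ[ℂ] Hol W where
  toFun f := ⟨fun w => f (ψ w), by
    obtain ⟨f, F, hF, hf⟩ := f
    obtain ⟨Ψ, hΨ, h⟩ := hψ
    refine ⟨F ∘ Ψ, hF.comp hΨ (fun w hw => ?_), fun w => ?_⟩
    · rw [← h ⟨w, hw⟩]
      exact (ψ ⟨w, hw⟩).2
    · rw [Function.comp_apply, ← h w]
      exact hf (ψ w)⟩
  map_add' _ _ := rfl
  map_smul' _ _ := rfl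

/-- The data of an equivalence transformation: a change of variables `z' = φ(z)`, `θ' = β(z) θ`
with `φ : V → W` biholomorphic, and a gauge factor `α(z)`. The functions `α` and `β` are units of
the algebra of analytic functions, that is, non-vanishing analytic functions. -/
structure Transformation (V W : Opens ℂ) where
  φ : V ≃ W
  analytic_φ : (fun z => (φ z : ℂ)) ∈ holSubalgebra V
  analytic_symm : (fun w => (φ.symm w : ℂ)) ∈ holSubalgebra W
  α : (Hol V)ˣ
  β : (Hol V)ˣ

/-- The change of the even variable on functions, `a ↦ a ∘ φ⁻¹`. -/
def Transformation.compEquiv {V W : Opens ℂ} (τ : Transformation V W) : Hol V ≃ₗ[ℂ] Hol W :=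
  LinearEquiv.ofLinearMap (compHol τ.φ.symm τ.analytic_symm) (compHol τ.φ τ.analytic_φ)
    (by
      refine LinearMap.ext fun f => Hol.ext fun w => ?_
      exact congrArg (fun x => f x) (τ.φ.apply_symm_apply w))
    (by
      refine LinearMap.ext fun f => Hol.ext fun z => ?_
      exact congrArg (fun x => f x) (τ.φ.symm_apply_apply z))

/-- The action on Grassmann-valued functions: `F = a + b θ` is multiplied by `α` and then rewritten
in the variables `z' = φ(z)`, `θ' = β(z) θ`, which gives
`(α a) ∘ φ⁻¹ + ((α β⁻¹ b) ∘ φ⁻¹) θ'`. -/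
def Transformation.funEquiv {V W : Opens ℂ} (τ : Transformation V W) :
    SuperFun V ≃ₗ[ℂ] SuperFun W :=
  LinearEquiv.prodCongr
    ((DistribMulAction.toLinearEquiv ℂ (Hol V) τ.α).trans τ.compEquiv)
    ((DistribMulAction.toLinearEquiv ℂ (Hol V) (τ.α * τ.β⁻¹)).trans τ.compEquiv)

/-- Two spaces of operators are equivalent if one fixed transformation maps one onto the other,
an operator `T` being mapped to its conjugate by the action on functions. -/
def Equivalent {V W : Opens ℂ} (L : Submodule ℂ (Op V)) (L' : Submodule ℂ (Op W)) : Prop :=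
  ∃ τ : Transformation V W, L' = L.map (τ.funEquiv.conj : Op V →ₗ[ℂ] Op W)

/-- `⟨ε θ∂_θ + h₁ ; h_l⟩` with finitely many (possibly no) linearly independent functions `h_l`. -/
def IsType0 {W : Opens ℂ} (L : Submodule ℂ (Op W)) : Prop :=
  ∃ (ε : ℂ) (h₁ : Hol W) (n : ℕ) (h : Fin n → Hol W),
    (ε = 0 ∨ ε = 1) ∧ LinearIndependent ℂ h ∧
    L = Submodule.span ℂ
      ({ε • (theta W * dtheta W) + mulOp h₁} ∪ Set.range fun l => mulOp (h l))

/-- `⟨∂_z ; ε θ∂_θ + α z^(s₀+1), z^l e^(σz) | 0 ≤ l ≤ s_σ, σ ∈ S⟩`, where `s₀ = -1` if `0 ∉ S`. -/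
def IsType1 {W : Opens ℂ} (L : Submodule ℂ (Op W)) : Prop :=
  ∃ (ε α : ℂ) (S : Finset ℂ) (s : ℂ → ℕ),
    (ε = 0 ∨ ε = 1) ∧ (ε = 0 → α = 0) ∧
    L = Submodule.span ℂ
      ({dz W,
        ε • (theta W * dtheta W) + α • mulOp (coord W ^ (if (0 : ℂ) ∈ S then s 0 + 1 else 0))} ∪
        {T | ∃ σ ∈ S, ∃ l ≤ s σ, T = mulOp (coord W ^ l * expFun W σ)})

/-- `⟨∂_z, z∂_z + α θ∂_θ + β ; ε θ∂_θ + γ, z^l | 0 ≤ l ≤ s⟩`, with `n = s + 1`, so that `n = 0`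
if no power of `z` is present. -/
def IsType2 {W : Opens ℂ} (L : Submodule ℂ (Op W)) : Prop :=
  ∃ (ε α β γ : ℂ) (n : ℕ),
    (ε = 0 ∨ ε = 1) ∧
    L = Submodule.span ℂ
      ({dz W,
        mulOp (coord W) * dz W + α • (theta W * dtheta W) + β • (1 : Op W),
        ε • (theta W * dtheta W) + γ • (1 : Op W)} ∪
        {T | ∃ l < n, T = mulOp (coord W ^ l)})

/-- `⟨∂_z, z∂_z + α θ∂_θ + β, z²∂_z + 2α z θ∂_θ + 2β z ; ε θ∂_θ + γ, 1⟩`, where the proposition `p`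
says whether the generator `1` is present. -/
def IsType3 {W : Opens ℂ} (L : Submodule ℂ (Op W)) : Prop :=
  ∃ (ε α β γ : ℂ) (p : Prop),
    (ε = 0 ∨ ε = 1) ∧
    L = Submodule.span ℂ
      ({dz W,
        mulOp (coord W) * dz W + α • (theta W * dtheta W) + β • (1 : Op W),
        mulOp (coord W ^ 2) * dz W + (2 * α) • (mulOp (coord W) * theta W * dtheta W)
          + (2 * β) • mulOp (coord W),
        ε • (theta W * dtheta W) + γ • (1 : Op W)} ∪
        {T | p ∧ T = 1})

/-- `z₀` is a regular point of the space `L` of even operators: the vector fields `f ∂_z` that occur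
in the elements `f ∂_z + g θ∂_θ + h` of `L` do not all vanish at `z₀`, unless they are all zero. -/
def IsRegularPoint {U : Opens ℂ} (L : Submodule ℂ (Op U)) (z₀ : U) : Prop :=
  (∀ f g h : Hol U, evenOp f g h ∈ L → f = 0) ∨
    ∃ f g h : Hol U, evenOp f g h ∈ L ∧ f z₀ ≠ 0

end

end SuperDiff

namespace SuperDiff

noncomputable section

/-!
An odd element of `𝔰` constrains the even part: an even operator `g θ∂_θ + h` without `∂_z` term
acts by commutation on the finite-dimensional odd part, and comparing the coefficients of an
eigenvector of this action shows that `g` is constant.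

Suppose that `p ∈ 𝔰₀` has a vector field that does not vanish at `z₀`. Bracketing with `p` lowers
the order of vanishing at `z₀` by one, so unless the vector fields of `𝔰₀` form a line, some
`x₁ ∈ 𝔰₀` has a vector field vanishing at `z₀` to exactly first order, normalized to derivative `1`.
The vector fields in the image of `ad x₁ + 1` all vanish at `z₀`, so this endomorphism of `𝔰₀` is
not surjective, hence not injective, and `[x₁, x₀] = -x₀` for some `x₀ ≠ 0`, which cannot vanish at
`z₀`. One transformation turns `x₀` into `∂_z` on a disc and then `x₁` into `z∂_z + α θ∂_θ + β`.

What remains is algebra. A finite-dimensional space of functions stable under `∂_z` is spanned by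
functions `z^l e^(σz)`, and by powers of `z` if it is also stable under `z∂_z`. This describes the
functions in `𝔰₀` and, in the presence of `x₁`, its vector fields, which contain no power beyond
`z²∂_z` since `[z^n∂_z, z^(n+1)∂_z] = z^(2 n)∂_z`.
-/

/-! ### Analytic functions on an open set -/

section Hol

variable {U : Opens ℂ}

theorem Hol.add_apply (f g : Hol U) (x : U) : (f + g) x = f x + g x := rfl

theorem Hol.sub_apply (f g : Hol U) (x : U) : (f - g) x = f x - g x := rfl

theorem Hol.mul_apply (f g : Hol U) (x : U) : (f * g) x = f x * g x := rfl

theorem Hol.smul_apply (c : ℂ) (f : Hol U) (x : U) : (c • f) x = c * f x := rfl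

theorem Hol.one_apply (x : U) : (1 : Hol U) x = 1 := rfl

theorem extendZero_eqOn {f : U → ℂ} {F : ℂ → ℂ} (hF : ∀ x : U, f x = F x) :
    Set.EqOn (extendZero f) F U := fun z hz => (extendZero_apply f ⟨z, hz⟩).trans (hF ⟨z, hz⟩)

theorem extendZero_eventuallyEq {f : U → ℂ} {F : ℂ → ℂ} (hF : ∀ x : U, f x = F x) (x : U) :
    extendZero f =ᶠ[nhds (x : ℂ)] F :=
  (extendZero_eqOn hF).eventuallyEq_of_mem (U.isOpen.mem_nhds x.2)

theorem extendZero_mul (f g : U → ℂ) : extendZero (f * g) = extendZero f * extendZero g := by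
  simpa [extendZero] using Function.extend_mul (Subtype.val : U → ℂ) f g 0 0

theorem analyticAt_extendZero (f : Hol U) (x : U) : AnalyticAt ℂ (extendZero ⇑f) x :=
  analyticOnNhd_extendZero f x x.2

theorem hasDerivAt_extendZero (f : Hol U) (x : U) :
    HasDerivAt (extendZero ⇑f) (derivHol U f x) x :=
  (analyticAt_extendZero f x).differentiableAt.hasDerivAt

theorem derivHol_apply_of_hasDerivAt {f : Hol U} {F : ℂ → ℂ} (hF : ∀ x : U, f x = F x) {x : U}
    {d : ℂ} (hd : HasDerivAt F d x) : derivHol U f x = d :=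
  (hasDerivAt_extendZero f x).unique (hd.congr_of_eventuallyEq (extendZero_eventuallyEq hF x))

theorem derivHol_mul (f g : Hol U) :
    derivHol U (f * g) = derivHol U f * g + f * derivHol U g := by
  refine Hol.ext fun x => derivHol_apply_of_hasDerivAt
    (fun y => (extendZero_apply ⇑(f * g) y).symm) ?_
  have h := (hasDerivAt_extendZero f x).mul (hasDerivAt_extendZero g x)
  rw [extendZero_apply, extendZero_apply, ← extendZero_mul] at h
  exact h

theorem derivHol_one : derivHol U 1 = 0 :=
  Hol.ext fun _ => derivHol_apply_of_hasDerivAt (F := fun _ => 1) (fun _ => rfl)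
    (hasDerivAt_const _ _)

theorem derivHol_coord : derivHol U (coord U) = 1 :=
  Hol.ext fun _ => derivHol_apply_of_hasDerivAt (F := id) (fun _ => rfl) (hasDerivAt_id _)

theorem derivHol_coord_pow (n : ℕ) :
    derivHol U (coord U ^ n) = (n : ℂ) • coord U ^ (n - 1) :=
  Hol.ext fun _ => derivHol_apply_of_hasDerivAt (F := fun z => z ^ n) (fun _ => rfl)
    (hasDerivAt_pow n _)

theorem derivHol_expFun (σ : ℂ) : derivHol U (expFun U σ) = σ • expFun U σ := by
  refine Hol.ext fun x => derivHol_apply_of_hasDerivAt (F := fun z => Complex.exp (σ * z))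
    (fun _ => rfl) ?_
  have h := ((hasDerivAt_id (x : ℂ)).const_mul σ).cexp
  rw [mul_one, mul_comm] at h
  exact h

theorem expFun_zero : expFun U 0 = 1 :=
  Hol.ext fun x => (congrArg Complex.exp (zero_mul (x : ℂ))).trans Complex.exp_zero

theorem isUnit_expFun (σ : ℂ) : IsUnit (expFun U σ) := by
  refine IsUnit.of_mul_eq_one (expFun U (-σ)) (Hol.ext fun x => ?_)
  change Complex.exp (σ * x) * Complex.exp (-σ * x) = 1
  rw [neg_mul, Complex.exp_neg, mul_inv_cancel₀ (Complex.exp_ne_zero _)]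

theorem Hol.eq_zero_of_eventually (hU : IsPreconnected (U : Set ℂ)) {f : Hol U} (x : U)
    (h : extendZero ⇑f =ᶠ[nhds (x : ℂ)] 0) : f = 0 := by
  refine Hol.ext fun y => ?_
  rw [← extendZero_apply ⇑f y]
  exact (analyticOnNhd_extendZero f).eqOn_zero_of_preconnected_of_eventuallyEq_zero hU x.2 h y.2

theorem Hol.eq_zero_or_eq_zero_of_mul (hU : IsPreconnected (U : Set ℂ)) {f g : Hol U}
    (h : f * g = 0) : f = 0 ∨ g = 0 := by
  have hfg : ∀ z ∈ (U : Set ℂ), extendZero ⇑f z * extendZero ⇑g z = 0 := fun z hz => by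
    rw [← Pi.mul_apply, ← extendZero_mul]
    exact extendZero_eqOn (F := 0) (congrFun (congrArg Subtype.val h)) hz
  refine ((analyticOnNhd_extendZero f).eq_zero_or_eq_zero_of_mul_eq_zero
    (analyticOnNhd_extendZero g) hfg hU).imp (fun h0 => Hol.ext fun y => ?_)
      fun h0 => Hol.ext fun y => ?_
  · exact (extendZero_apply ⇑f y).symm.trans (h0 y y.2)
  · exact (extendZero_apply ⇑g y).symm.trans (h0 y y.2)

theorem Hol.eq_smul_one_of_mul_eq_smul (hU : IsPreconnected (U : Set ℂ)) {f g : Hol U} {c : ℂ}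
    (hf : f ≠ 0) (h : g * f = c • f) : g = c • (1 : Hol U) := by
  have hmul : (g - c • (1 : Hol U)) * f = 0 := by
    rw [sub_mul, h, smul_mul_assoc, one_mul, sub_self]
  exact sub_eq_zero.1 ((Hol.eq_zero_or_eq_zero_of_mul hU hmul).resolve_right hf)

theorem Hol.exists_eq_smul_one_of_derivHol_eq_zero (hU : IsPreconnected (U : Set ℂ)) {f : Hol U}
    (h : derivHol U f = 0) : ∃ c : ℂ, f = c • (1 : Hol U) := by
  obtain ⟨c, hc⟩ := U.isOpen.exists_is_const_of_deriv_eq_zero hU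
    (analyticOnNhd_extendZero f).differentiableOn
    fun x hx => congrArg (fun k : Hol U => k ⟨x, hx⟩) h
  refine ⟨c, Hol.ext fun x => ?_⟩
  rw [← extendZero_apply ⇑f x, hc x x.2, Hol.smul_apply, Hol.one_apply, mul_one]

theorem Hol.exists_derivHol_eq_of_ball {c : ℂ} {r : ℝ} (hU : (U : Set ℂ) = Metric.ball c r)
    (f : Hol U) : ∃ F : Hol U, derivHol U F = f := by
  have hd : DifferentiableOn ℂ (extendZero ⇑f) (Metric.ball c r) :=
    hU ▸ (analyticOnNhd_extendZero f).differentiableOn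
  obtain ⟨F, hF⟩ := hd.isExactOn_ball
  have hFd : DifferentiableOn ℂ F (U : Set ℂ) := fun z hz =>
    (hF z (hU ▸ hz)).differentiableAt.differentiableWithinAt
  refine ⟨⟨fun x => F x, F, hFd.analyticOnNhd U.isOpen, fun _ => rfl⟩, Hol.ext fun x => ?_⟩
  rw [← extendZero_apply ⇑f x]
  exact derivHol_apply_of_hasDerivAt (fun _ => rfl) (hF x (hU ▸ x.2))

theorem Hol.isUnit_of_ne_zero {f : Hol U} (h : ∀ x : U, f x ≠ 0) : IsUnit f := by
  have hne : ∀ z ∈ (U : Set ℂ), extendZero ⇑f z ≠ 0 := fun z hz =>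
    (extendZero_apply ⇑f ⟨z, hz⟩).trans_ne (h _)
  refine IsUnit.of_mul_eq_one ⟨fun x => (f x)⁻¹, _, (analyticOnNhd_extendZero f).inv hne,
    fun x => congrArg Inv.inv (extendZero_apply ⇑f x).symm⟩ (Hol.ext fun x => ?_)
  exact mul_inv_cancel₀ (h x)

/-- The exponential of an analytic function; a gauge factor with prescribed logarithmic
derivative is obtained as the exponential of a primitive. -/
def Hol.cexp (p : Hol U) : Hol U :=
  ⟨fun x => Complex.exp (p x), fun z => Complex.exp (extendZero ⇑p z),
    (analyticOnNhd_extendZero p).cexp,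
    fun x => (congrArg Complex.exp (extendZero_apply ⇑p x)).symm⟩

theorem Hol.derivHol_cexp (p : Hol U) : derivHol U p.cexp = derivHol U p * p.cexp := by
  refine Hol.ext fun x => derivHol_apply_of_hasDerivAt
    (F := fun z => Complex.exp (extendZero ⇑p z))
    (fun y => (congrArg Complex.exp (extendZero_apply ⇑p y)).symm) ?_
  have h := (hasDerivAt_extendZero p x).cexp
  rw [extendZero_apply, mul_comm] at h
  exact h

theorem Hol.isUnit_cexp (p : Hol U) : IsUnit p.cexp :=
  Hol.isUnit_of_ne_zero fun _ => Complex.exp_ne_zero _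

theorem derivHol_resHol {V : Opens ℂ} (hVU : V ≤ U) (f : Hol U) :
    derivHol V (resHol hVU f) = resHol hVU (derivHol U f) :=
  Hol.ext fun x => derivHol_apply_of_hasDerivAt (F := extendZero ⇑f)
    (fun y => (extendZero_apply ⇑f ⟨y, hVU y.2⟩).symm) (hasDerivAt_extendZero f ⟨x, hVU x.2⟩)

theorem resHol_mul {V : Opens ℂ} (hVU : V ≤ U) (f g : Hol U) :
    resHol hVU (f * g) = resHol hVU f * resHol hVU g := rfl

theorem resHol_eq_zero (hU : IsPreconnected (U : Set ℂ)) {V : Opens ℂ} (hVU : V ≤ U)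
    (x : V) {f : Hol U} (h : resHol hVU f = 0) : f = 0 := by
  refine Hol.eq_zero_of_eventually hU ⟨x, hVU x.2⟩ ?_
  filter_upwards [V.isOpen.mem_nhds x.2] with z hz
  exact (extendZero_apply ⇑f ⟨z, hVU hz⟩).trans (congrArg (fun k : Hol V => k ⟨z, hz⟩) h)

end Hol

/-! ### Coefficients of first-order operators -/

section Coeff

variable {U V : Opens ℂ}

theorem mulOp_apply (h : Hol U) (p : SuperFun U) : mulOp h p = (h * p.1, h * p.2) := rfl

theorem mulOp_one : mulOp (1 : Hol U) = 1 :=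
  LinearMap.ext fun p => by rw [mulOp_apply, one_mul, one_mul]; rfl

theorem evenOp_apply (f g h : Hol U) (p : SuperFun U) :
    evenOp f g h p =
      (f * derivHol U p.1 + h * p.1, f * derivHol U p.2 + g * p.2 + h * p.2) := by
  change (f * derivHol U p.1 + g * 0 + h * p.1, f * derivHol U p.2 + g * p.2 + h * p.2) = _
  rw [mul_zero, add_zero]

theorem oddOp_apply (φ χ ω : Hol U) (p : SuperFun U) :
    oddOp φ χ ω p = (χ * p.2, φ * derivHol U p.1 + ω * p.1) := by
  change (0 + χ * p.2 + ω * 0, φ * derivHol U p.1 + χ * 0 + ω * p.1) = _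
  rw [mul_zero, mul_zero, add_zero, zero_add, add_zero]

/-- Triples of coefficients: `(f, g, h)` stands for the even operator `f ∂_z + g θ∂_θ + h`, and
`(φ, χ, ω)` for the odd operator `θ φ ∂_z + χ ∂_θ + ω θ`. -/
abbrev Coeff (U : Opens ℂ) : Type := Hol U × Hol U × Hol U

/-- The even operator with given coefficients. -/
def evenMap (U : Opens ℂ) : Coeff U →ₗ[ℂ] Op U where
  toFun x := evenOp x.1 x.2.1 x.2.2
  map_add' x y := by
    simp only [evenOp, mulOp_add, add_mul, Prod.fst_add, Prod.snd_add]
    abel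
  map_smul' c x := by simp [evenOp, mulOp_smul]

theorem evenMap_apply (f g h : Hol U) : evenMap U (f, g, h) = evenOp f g h := rfl

/-- The odd operator with given coefficients. -/
def oddMap (U : Opens ℂ) : Coeff U →ₗ[ℂ] Op U where
  toFun x := oddOp x.1 x.2.1 x.2.2
  map_add' x y := by
    simp only [oddOp, mulOp_add, add_mul, mul_add, Prod.fst_add, Prod.snd_add]
    abel
  map_smul' c x := by simp [oddOp, mulOp_smul]

theorem oddMap_apply (φ χ ω : Hol U) : oddMap U (φ, χ, ω) = oddOp φ χ ω := rfl

theorem evenSpace_eq_range (U : Opens ℂ) : evenSpace U = LinearMap.range (evenMap U) :=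
  Submodule.ext fun _ => ⟨fun ⟨f, g, h, e⟩ => ⟨(f, g, h), e.symm⟩,
    fun ⟨x, e⟩ => ⟨x.1, x.2.1, x.2.2, e.symm⟩⟩

theorem oddSpace_eq_range (U : Opens ℂ) : oddSpace U = LinearMap.range (oddMap U) :=
  Submodule.ext fun _ => ⟨fun ⟨φ, χ, ω, e⟩ => ⟨(φ, χ, ω), e.symm⟩,
    fun ⟨x, e⟩ => ⟨x.1, x.2.1, x.2.2, e.symm⟩⟩

theorem evenMap_mem_evenSpace (x : Coeff U) : evenMap U x ∈ evenSpace U :=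
  ⟨x.1, x.2.1, x.2.2, rfl⟩

theorem oddMap_mem_oddSpace (x : Coeff U) : oddMap U x ∈ oddSpace U :=
  ⟨x.1, x.2.1, x.2.2, rfl⟩

theorem eq_zero_of_evenMap_add_oddMap_eq_zero {x y : Coeff U}
    (h_one : (evenMap U x + oddMap U y) (1, 0) = 0)
    (h_theta : (evenMap U x + oddMap U y) (0, 1) = 0)
    (h_coord : (evenMap U x + oddMap U y) (coord U, 0) = 0) : x = 0 ∧ y = 0 := by
  obtain ⟨f, g, h⟩ := x
  obtain ⟨φ, χ, ω⟩ := y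
  simp only [LinearMap.add_apply, evenMap_apply, oddMap_apply, evenOp_apply, oddOp_apply, map_zero,
    derivHol_one, derivHol_coord, mul_zero, mul_one, add_zero, zero_add, Prod.mk_add_mk,
    Prod.mk_eq_zero] at h_one h_theta h_coord ⊢
  obtain ⟨rfl, rfl⟩ := h_one
  obtain ⟨rfl, hg⟩ := h_theta
  simp only [zero_mul, add_zero] at hg h_coord
  exact ⟨⟨h_coord.1, hg, rfl⟩, h_coord.2, rfl, rfl⟩

theorem evenMap_injective : Function.Injective (evenMap U) :=
  (injective_iff_map_eq_zero _).2 fun x hx => by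
    refine (eq_zero_of_evenMap_add_oddMap_eq_zero (y := 0) ?_ ?_ ?_).1 <;>
      rw [hx, map_zero, add_zero, LinearMap.zero_apply]

theorem oddMap_injective : Function.Injective (oddMap U) :=
  (injective_iff_map_eq_zero _).2 fun y hy => by
    refine (eq_zero_of_evenMap_add_oddMap_eq_zero (x := 0) ?_ ?_ ?_).2 <;>
      rw [hy, map_zero, add_zero, LinearMap.zero_apply]

/-- The Lie bracket of even operators in terms of their coefficients. -/
def bracket (x y : Coeff U) : Coeff U :=
  (x.1 * derivHol U y.1 - y.1 * derivHol U x.1,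
    x.1 * derivHol U y.2.1 - y.1 * derivHol U x.2.1,
    x.1 * derivHol U y.2.2 - y.1 * derivHol U x.2.2)

theorem evenMap_bracket (x y : Coeff U) :
    evenMap U (bracket x y) = evenMap U x * evenMap U y - evenMap U y * evenMap U x := by
  obtain ⟨f, g, h⟩ := x
  obtain ⟨f', g', h'⟩ := y
  refine LinearMap.ext fun p => ?_
  simp only [bracket, evenMap_apply, LinearMap.sub_apply, Module.End.mul_apply, evenOp_apply,
    Prod.mk_sub_mk, map_add, derivHol_mul]
  ext1 <;> simp only <;> ring

theorem evenMap_mul_oddMap_sub (g h φ χ ω : Hol U) :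
    evenMap U (0, g, h) * oddMap U (φ, χ, ω) - oddMap U (φ, χ, ω) * evenMap U (0, g, h) =
      oddMap U (g * φ, -(g * χ), g * ω - φ * derivHol U h) := by
  refine LinearMap.ext fun p => ?_
  simp only [evenMap_apply, oddMap_apply, LinearMap.sub_apply, Module.End.mul_apply, evenOp_apply,
    oddOp_apply, Prod.mk_sub_mk, map_add, map_zero, derivHol_mul]
  ext1 <;> simp only <;> ring

/-- The coefficients of the even elements of a space of operators. -/
def coeffSpace (s : Submodule ℂ (Op U)) : Submodule ℂ (Coeff U) := s.comap (evenMap U)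

theorem evenPart_eq_map (s : Submodule ℂ (Op U)) :
    evenPart s = (coeffSpace s).map (evenMap U) := by
  rw [coeffSpace, Submodule.map_comap_eq, ← evenSpace_eq_range, inf_comm]
  rfl

theorem evenOp_mem_evenPart_iff {s : Submodule ℂ (Op U)} {f g h : Hol U} :
    evenOp f g h ∈ evenPart s ↔ (f, g, h) ∈ coeffSpace s :=
  ⟨fun hx => hx.1, fun hx => ⟨hx, f, g, h, rfl⟩⟩

/-- Restriction of coefficients to a smaller open set. -/
def resCoeff (hVU : V ≤ U) : Coeff U →ₗ[ℂ] Coeff V :=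
  (resHol hVU).prodMap ((resHol hVU).prodMap (resHol hVU))

theorem resCoeff_bracket (hVU : V ≤ U) (x y : Coeff U) :
    resCoeff hVU (bracket x y) = bracket (resCoeff hVU x) (resCoeff hVU y) := by
  simp only [resCoeff, bracket, LinearMap.prodMap_apply, derivHol_resHol, map_sub, resHol_mul]

theorem evenMap_resCoeff (hVU : V ≤ U) (x : Coeff U) :
    evenMap V (resCoeff hVU x) ∘ₗ resFun hVU = resFun hVU ∘ₗ evenMap U x := by
  obtain ⟨f, g, h⟩ := x
  refine LinearMap.ext fun p => ?_
  change evenOp _ _ _ (resHol hVU p.1, resHol hVU p.2) = resFun hVU (evenOp _ _ _ _)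
  rw [evenOp_apply, evenOp_apply, derivHol_resHol, derivHol_resHol]
  rfl

theorem eq_evenMap_of_comp_resFun_eq (hVU : V ≤ U) {S : Op V} (hS : S ∈ firstOrder V)
    {x : Coeff V} (h : S ∘ₗ resFun hVU = evenMap V x ∘ₗ resFun hVU) : S = evenMap V x := by
  rw [firstOrder, evenSpace_eq_range, oddSpace_eq_range] at hS
  obtain ⟨_, ⟨x', rfl⟩, _, ⟨y, rfl⟩, rfl⟩ := Submodule.mem_sup.1 hS
  have hres : ∀ q, (evenMap V (x' - x) + oddMap V y) (resFun hVU q) = 0 := fun q => by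
    rw [map_sub, sub_add_eq_add_sub, LinearMap.sub_apply, sub_eq_zero]
    exact LinearMap.congr_fun h q
  obtain ⟨hx, rfl⟩ := eq_zero_of_evenMap_add_oddMap_eq_zero
    (hres (1, 0)) (hres (0, 1)) (hres (coord U, 0))
  rw [sub_eq_zero.1 hx, map_zero, add_zero]

theorem restrictOps_map_evenMap (hVU : V ≤ U) (M : Submodule ℂ (Coeff U)) :
    restrictOps hVU (M.map (evenMap U)) = (M.map (resCoeff hVU)).map (evenMap V) := by
  ext S
  constructor
  · rintro ⟨hS, _, ⟨x, hx, rfl⟩, e⟩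
    rw [← evenMap_resCoeff] at e
    exact ⟨_, ⟨x, hx, rfl⟩, (eq_evenMap_of_comp_resFun_eq hVU hS e).symm⟩
  · rintro ⟨_, ⟨x, hx, rfl⟩, rfl⟩
    exact ⟨Submodule.mem_sup_left (evenMap_mem_evenSpace _), _, ⟨x, hx, rfl⟩,
      evenMap_resCoeff hVU x⟩

end Coeff

/-! ### Admissible spaces of coefficients -/

section Admissible

variable {U V : Opens ℂ}

/-- Finite-dimensional Lie algebras of even operators, given by their coefficients, in which the
coefficient of `θ∂_θ` in every operator without `∂_z` term is constant. The even parts of the graded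
subalgebras with an odd element are of this kind, and only this is used to find normal forms. -/
structure IsAdmissible (M : Submodule ℂ (Coeff U)) : Prop where
  finiteDimensional : FiniteDimensional ℂ M
  bracket_mem : ∀ x ∈ M, ∀ y ∈ M, bracket x y ∈ M
  exists_eq_smul_one : ∀ g h, ((0, g, h) : Coeff U) ∈ M → ∃ c : ℂ, g = c • (1 : Hol U)

theorem IsAdmissible.map {M : Submodule ℂ (Coeff U)} (hM : IsAdmissible M)
    {Φ : Coeff U →ₗ[ℂ] Coeff V} (hΦ : ∀ x y, Φ (bracket x y) = bracket (Φ x) (Φ y))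
    (hfst : ∀ x, (Φ x).1 = 0 → x.1 = 0) (hconst : ∀ (c : ℂ) h, (Φ (0, c • 1, h)).2.1 = c • 1) :
    IsAdmissible (M.map Φ) where
  finiteDimensional := by
    have := hM.finiteDimensional
    infer_instance
  bracket_mem := by
    rintro _ ⟨x, hx, rfl⟩ _ ⟨y, hy, rfl⟩
    exact ⟨bracket x y, hM.bracket_mem x hx y hy, hΦ x y⟩
  exists_eq_smul_one := by
    rintro g h ⟨⟨f', g', h'⟩, hx, e⟩
    obtain rfl : f' = 0 := hfst _ (congrArg Prod.fst e)
    obtain ⟨c, rfl⟩ := hM.exists_eq_smul_one g' h' hx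
    exact ⟨c, by rw [← hconst c h', e]⟩

theorem IsAdmissible.map_resCoeff (hU : IsPreconnected (U : Set ℂ)) {M : Submodule ℂ (Coeff U)}
    (hM : IsAdmissible M) (hVU : V ≤ U) (z : V) : IsAdmissible (M.map (resCoeff hVU)) :=
  hM.map (resCoeff_bracket hVU) (fun _ h => resHol_eq_zero hU hVU z h) fun _ _ => rfl

theorem exists_odd_eigenvector {s : Submodule ℂ (Op U)} (hs : IsGradedSubalgebra s)
    [FiniteDimensional ℂ s] (hodd : oddPart s ≠ ⊥) {g h : Hol U}
    (hgh : evenMap U (0, g, h) ∈ s) :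
    ∃ (c : ℂ) (φ χ ω : Hol U), ¬ (φ = 0 ∧ χ = 0 ∧ ω = 0) ∧
      g * φ = c • φ ∧ -(g * χ) = c • χ ∧ g * ω - φ * derivHol U h = c • ω := by
  set T := evenMap U (0, g, h)
  have hT : T ∈ evenPart s := ⟨hgh, evenMap_mem_evenSpace _⟩
  have hstable : ∀ X ∈ oddPart s,
      (LinearMap.mulLeft ℂ T - LinearMap.mulRight ℂ T) X ∈ oddPart s := by
    rintro X ⟨hX, hXodd⟩
    refine ⟨hs.even_odd _ hT _ ⟨hX, hXodd⟩, ?_⟩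
    obtain ⟨φ, χ, ω, rfl⟩ := hXodd
    have := oddMap_mem_oddSpace (g * φ, -(g * χ), g * ω - φ * derivHol U h)
    rwa [← evenMap_mul_oddMap_sub] at this
  have : Nontrivial (oddPart s) := Submodule.nontrivial_iff_ne_bot.2 hodd
  have : FiniteDimensional ℂ (oddPart s) := Submodule.finiteDimensional_inf_left s (oddSpace U)
  let adT : Module.End ℂ (oddPart s) :=
    (LinearMap.mulLeft ℂ T - LinearMap.mulRight ℂ T).restrict hstable
  obtain ⟨c, hc⟩ := Module.End.exists_eigenvalue (V := oddPart s) adT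
  obtain ⟨⟨_, hX, φ, χ, ω, rfl⟩, hXe, hX0⟩ := hc.exists_hasEigenvector
  have he : oddMap U (g * φ, -(g * χ), g * ω - φ * derivHol U h) = c • oddMap U (φ, χ, ω) :=
    (evenMap_mul_oddMap_sub g h φ χ ω).symm.trans
      (congrArg Subtype.val (Module.End.mem_eigenspace_iff.1 hXe))
  rw [← map_smul] at he
  obtain ⟨hφ, hχ, hω⟩ := by simpa only [Prod.smul_mk, Prod.mk.injEq] using oddMap_injective he
  refine ⟨c, φ, χ, ω, ?_, hφ, hχ, hω⟩
  rintro ⟨rfl, rfl, rfl⟩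
  exact hX0 (Subtype.ext (map_zero (oddMap U)))

theorem isAdmissible_coeffSpace (hU : IsPreconnected (U : Set ℂ)) {s : Submodule ℂ (Op U)}
    (hs : IsGradedSubalgebra s) [FiniteDimensional ℂ s] (hodd : oddPart s ≠ ⊥) :
    IsAdmissible (coeffSpace s) where
  finiteDimensional := by
    have : FiniteDimensional ℂ (LinearMap.ker (evenMap U)) := by
      rw [LinearMap.ker_eq_bot.2 evenMap_injective]
      infer_instance
    exact inferInstanceAs (FiniteDimensional ℂ (s.comap (evenMap U)))
  bracket_mem x hx y hy := by
    change evenMap U _ ∈ s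
    rw [evenMap_bracket]
    exact hs.even_even _ ⟨hx, evenMap_mem_evenSpace x⟩ _ ⟨hy, evenMap_mem_evenSpace y⟩
  exists_eq_smul_one g h hgh := by
    obtain ⟨c, φ, χ, ω, hne, hφ, hχ, hω⟩ := exists_odd_eigenvector hs hodd hgh
    by_cases hφ0 : φ = 0
    · subst hφ0
      by_cases hχ0 : χ = 0
      · rw [zero_mul, sub_zero] at hω
        exact ⟨c, Hol.eq_smul_one_of_mul_eq_smul hU (fun hω0 => hne ⟨rfl, hχ0, hω0⟩) hω⟩
      · refine ⟨-c, Hol.eq_smul_one_of_mul_eq_smul hU hχ0 ?_⟩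
        rw [neg_smul, ← hχ, neg_neg]
    · exact ⟨c, Hol.eq_smul_one_of_mul_eq_smul hU hφ0 hφ⟩

end Admissible

/-! ### Action of transformations on coefficients -/

section Transformation

variable {V W : Opens ℂ}

/-- The logarithmic derivative of a non-vanishing analytic function. -/
def logDerivHol (u : (Hol V)ˣ) : Hol V := (u⁻¹ : (Hol V)ˣ) * derivHol V u

theorem derivHol_unit_mul (u : (Hol V)ˣ) (k : Hol V) :
    derivHol V (u * k) = u * (derivHol V k + logDerivHol u * k) := by
  rw [derivHol_mul, logDerivHol, mul_add, mul_assoc, Units.mul_inv_cancel_left, add_comm]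

theorem logDerivHol_mul (u v : (Hol V)ˣ) :
    logDerivHol (u * v) = logDerivHol u + logDerivHol v := by
  rw [logDerivHol, Units.val_mul, derivHol_mul, mul_inv_rev, Units.val_mul, logDerivHol,
    logDerivHol]
  linear_combination (u⁻¹ : (Hol V)ˣ) * derivHol V u * v.inv_mul +
    (v⁻¹ : (Hol V)ˣ) * derivHol V v * u.inv_mul

theorem logDerivHol_mul_inv (u v : (Hol V)ˣ) :
    logDerivHol (u * v⁻¹) = logDerivHol u - logDerivHol v :=
  eq_sub_of_add_eq (by rw [← logDerivHol_mul, inv_mul_cancel_right])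

theorem logDerivHol_cexp (p : Hol V) : logDerivHol p.isUnit_cexp.unit = derivHol V p := by
  rw [logDerivHol, IsUnit.unit_spec, Hol.derivHol_cexp, mul_left_comm, IsUnit.val_inv_mul, mul_one]

namespace Transformation

variable (τ : Transformation V W)

/-- The pullback of functions `k ↦ k ∘ φ` along a transformation. -/
def pull : Hol W →ₐ[ℂ] Hol V :=
  AlgHom.ofLinearMap (compHol τ.φ τ.analytic_φ) rfl fun _ _ => rfl

theorem pull_compEquiv (k : Hol V) : τ.pull (τ.compEquiv k) = k := τ.compEquiv.symm_apply_apply k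

theorem pull_injective : Function.Injective τ.pull := τ.compEquiv.symm.injective

theorem pull_funEquiv_fst (p : SuperFun V) : τ.pull (τ.funEquiv p).1 = τ.α * p.1 :=
  τ.pull_compEquiv _

theorem pull_funEquiv_snd (p : SuperFun V) :
    τ.pull (τ.funEquiv p).2 = (τ.α * τ.β⁻¹ : (Hol V)ˣ) * p.2 :=
  τ.pull_compEquiv _

/-- The new even coordinate as an analytic function of the old one. -/
def newCoord : Hol V := ⟨_, τ.analytic_φ⟩

theorem derivHol_pull (k : Hol W) :
    derivHol V (τ.pull k) = τ.pull (derivHol W k) * derivHol V τ.newCoord := by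
  refine Hol.ext fun z => derivHol_apply_of_hasDerivAt
    (F := extendZero ⇑k ∘ extendZero ⇑τ.newCoord) (fun y => ?_) ?_
  · rw [Function.comp_apply, extendZero_apply ⇑τ.newCoord y]
    exact (extendZero_apply ⇑k (τ.φ y)).symm
  · refine HasDerivAt.comp (z : ℂ) ?_ (hasDerivAt_extendZero τ.newCoord z)
    rw [extendZero_apply ⇑τ.newCoord z]
    exact hasDerivAt_extendZero k (τ.φ z)

theorem isUnit_derivHol_newCoord : IsUnit (derivHol V τ.newCoord) := by
  refine IsUnit.of_mul_eq_one_right (τ.pull (derivHol W (τ.compEquiv (coord V)))) ?_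
  rw [← τ.derivHol_pull, τ.pull_compEquiv, derivHol_coord]

/-- The action of a transformation on the coefficients of even operators. -/
def pushCoeff : Coeff V →ₗ[ℂ] Coeff W where
  toFun x := (τ.compEquiv (x.1 * derivHol V τ.newCoord),
    τ.compEquiv (x.2.1 + x.1 * logDerivHol τ.β), τ.compEquiv (x.2.2 - x.1 * logDerivHol τ.α))
  map_add' x y := by
    simp only [Prod.fst_add, Prod.snd_add, add_mul, map_add, map_sub, Prod.mk_add_mk,
      add_add_add_comm, add_sub_add_comm]
  map_smul' c x := by simp [smul_sub]

theorem pushCoeff_apply (f g h : Hol V) :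
    τ.pushCoeff (f, g, h) = (τ.compEquiv (f * derivHol V τ.newCoord),
      τ.compEquiv (g + f * logDerivHol τ.β), τ.compEquiv (h - f * logDerivHol τ.α)) := rfl

theorem conj_evenMap (x : Coeff V) :
    τ.funEquiv.conj (evenMap V x) = evenMap W (τ.pushCoeff x) := by
  obtain ⟨f, g, h⟩ := x
  refine LinearMap.ext fun q => ?_
  obtain ⟨p, rfl⟩ := τ.funEquiv.surjective q
  rw [LinearEquiv.conj_apply_apply, LinearEquiv.symm_apply_apply, pushCoeff_apply, evenMap_apply,
    evenMap_apply, evenOp_apply, evenOp_apply]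
  have d_fst := τ.derivHol_pull (τ.funEquiv p).1
  have d_snd := τ.derivHol_pull (τ.funEquiv p).2
  rw [pull_funEquiv_fst, derivHol_unit_mul] at d_fst
  rw [pull_funEquiv_snd, derivHol_unit_mul, logDerivHol_mul_inv] at d_snd
  refine Prod.ext (τ.pull_injective ?_) (τ.pull_injective ?_)
  · simp only [pull_funEquiv_fst, map_add, map_mul, pull_compEquiv]
    linear_combination f * d_fst
  · simp only [pull_funEquiv_snd, map_add, map_mul, pull_compEquiv]
    linear_combination f * d_snd

theorem bracket_pushCoeff (x y : Coeff V) :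
    τ.pushCoeff (bracket x y) = bracket (τ.pushCoeff x) (τ.pushCoeff y) := by
  have conj_mul (A B : Op V) : τ.funEquiv.conj (A * B) = τ.funEquiv.conj A * τ.funEquiv.conj B :=
    τ.funEquiv.conj_comp B A
  apply evenMap_injective
  rw [evenMap_bracket, ← conj_evenMap, ← conj_evenMap, ← conj_evenMap, evenMap_bracket, map_sub,
    conj_mul, conj_mul]

theorem equivalent_map_pushCoeff (M : Submodule ℂ (Coeff V)) :
    Equivalent (M.map (evenMap V)) ((M.map τ.pushCoeff).map (evenMap W)) := by
  refine ⟨τ, ?_⟩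
  rw [← Submodule.map_comp, ← Submodule.map_comp]
  exact congrArg M.map (LinearMap.ext fun x => (τ.conj_evenMap x).symm)

end Transformation

theorem IsAdmissible.map_pushCoeff {M : Submodule ℂ (Coeff V)} (hM : IsAdmissible M)
    (τ : Transformation V W) : IsAdmissible (M.map τ.pushCoeff) := by
  refine hM.map τ.bracket_pushCoeff (fun x hx => ?_) fun c h => ?_
  · exact τ.isUnit_derivHol_newCoord.mul_left_eq_zero.1 (τ.compEquiv.map_eq_zero_iff.1 hx)
  · change τ.compEquiv (c • 1 + 0 * logDerivHol τ.β) = c • 1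
    rw [zero_mul, add_zero]
    rfl

theorem Equivalent.refl (L : Submodule ℂ (Op V)) : Equivalent L L := by
  let τ : Transformation V V := ⟨Equiv.refl V, (coord V).2, (coord V).2, 1, 1⟩
  have hτ : τ.funEquiv = LinearEquiv.refl ℂ _ := by
    refine LinearEquiv.ext fun p => Prod.ext (τ.pull_injective ?_) (τ.pull_injective ?_)
    · rw [τ.pull_funEquiv_fst]
      exact one_mul p.1
    · rw [τ.pull_funEquiv_snd, mul_inv_cancel]
      exact one_mul p.2
  refine ⟨τ, ?_⟩
  rw [hτ]
  exact (Submodule.map_id L).symm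

end Transformation

/-! ### Vector fields near a point where one of them does not vanish -/

section VectorFields

variable {U : Opens ℂ}

/-- The order of vanishing of an analytic function at a point. -/
def Hol.order (f : Hol U) (x : U) : ℕ∞ := analyticOrderAt (extendZero ⇑f) x

theorem Hol.order_eq_zero {f : Hol U} {x : U} : f.order x = 0 ↔ f x ≠ 0 := by
  rw [Hol.order, (analyticAt_extendZero f x).analyticOrderAt_eq_zero, extendZero_apply]

theorem Hol.order_mul (f g : Hol U) (x : U) : (f * g).order x = f.order x + g.order x := by
  rw [Hol.order, show ⇑(f * g) = ⇑f * ⇑g from rfl, extendZero_mul]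
  exact analyticOrderAt_mul (analyticAt_extendZero f x) (analyticAt_extendZero g x)

theorem Hol.le_order_add (f g : Hol U) (x : U) :
    min (f.order x) (g.order x) ≤ (f + g).order x := by
  refine le_analyticOrderAt_add.trans_eq ?_
  rw [Hol.order, show ⇑(f + g) = ⇑f + ⇑g from rfl, extendZero_add]

theorem Hol.order_derivHol_add_one {f : Hol U} {x : U} (h : f x = 0) :
    (derivHol U f).order x + 1 = f.order x := by
  rw [Hol.order, analyticOrderAt_congr (extendZero_eventuallyEq (f := derivHol U f)
      (F := deriv (extendZero ⇑f)) (fun _ => rfl) x),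
    (analyticAt_extendZero f x).analyticOrderAt_deriv_add_one, extendZero_apply, h, Hol.order]
  simp only [sub_zero]

theorem Hol.eq_zero_of_order_eq_top (hU : IsPreconnected (U : Set ℂ)) {f : Hol U} {x : U}
    (h : f.order x = ⊤) : f = 0 :=
  Hol.eq_zero_of_eventually hU x (analyticOrderAt_eq_top.1 h)

theorem exists_mem_derivHol_eq_one (hU : IsPreconnected (U : Set ℂ)) {F : Submodule ℂ (Hol U)}
    (hF : ∀ f ∈ F, ∀ g ∈ F, f * derivHol U g - g * derivHol U f ∈ F) {z₀ : U} {p k : Hol U}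
    (hp : p ∈ F) (hpz : p z₀ ≠ 0) (hk : k ∈ F) (hkz : k z₀ = 0) (hk0 : k ≠ 0) :
    ∃ f ∈ F, f z₀ = 0 ∧ derivHol U f z₀ = 1 := by
  suffices ∃ f ∈ F, f z₀ = 0 ∧ derivHol U f z₀ ≠ 0 by
    obtain ⟨f, hf, hfz, hf'⟩ := this
    refine ⟨(derivHol U f z₀)⁻¹ • f, F.smul_mem _ hf, ?_, ?_⟩
    · rw [Hol.smul_apply, hfz, mul_zero]
    · rw [map_smul, Hol.smul_apply, inv_mul_cancel₀ hf']
  by_contra! hdouble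
  -- The bracket with `p` lowers the order of vanishing by one.
  have le_order (n : ℕ) : ∀ f ∈ F, f z₀ = 0 → (n : ℕ∞) ≤ f.order z₀ := by
    induction n with
    | zero => exact fun _ _ _ => zero_le
    | succ n ih =>
      intro f hf hfz
      have h_bracket : (n : ℕ∞) ≤ (p * derivHol U f - f * derivHol U p).order z₀ := by
        refine ih _ (hF p hp f hf) ?_
        rw [Hol.sub_apply, Hol.mul_apply, Hol.mul_apply, hdouble f hf hfz, hfz, mul_zero, zero_mul,
          sub_zero]
      have h_mul : (n : ℕ∞) ≤ (f * derivHol U p).order z₀ := by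
        rw [Hol.order_mul]
        exact (ih f hf hfz).trans le_self_add
      have h_deriv := (le_min h_bracket h_mul).trans (Hol.le_order_add _ _ z₀)
      rw [sub_add_cancel, Hol.order_mul, Hol.order_eq_zero.2 hpz, zero_add] at h_deriv
      rw [← Hol.order_derivHol_add_one hfz]
      push_cast
      gcongr
  exact hk0 (Hol.eq_zero_of_order_eq_top hU
    (ENat.eq_top_iff_forall_ge.2 fun n => le_order n k hk hkz))

theorem Hol.eq_zero_of_bracket_eq_neg (hU : IsPreconnected (U : Set ℂ)) {f k : Hol U} {z₀ : U}
    (hfz : f z₀ = 0) (hf' : derivHol U f z₀ = 1)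
    (h : f * derivHol U k - k * derivHol U f = -k) (hkz : k z₀ = 0) : k = 0 := by
  by_contra hk0
  have hf_order : f.order z₀ = 1 := by
    rw [← Hol.order_derivHol_add_one hfz, Hol.order_eq_zero.2 (hf'.trans_ne one_ne_zero), zero_add]
  have h_order : (f * derivHol U k).order z₀ = ((derivHol U f - 1) * k).order z₀ :=
    congrArg (Hol.order · z₀) (by linear_combination h)
  rw [Hol.order_mul, Hol.order_mul, hf_order, add_comm, Hol.order_derivHol_add_one hkz] at h_order
  have hk_order : k.order z₀ ≠ ⊤ := fun h_top => hk0 (Hol.eq_zero_of_order_eq_top hU h_top)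
  have h_zero : 0 = (derivHol U f - 1).order z₀ :=
    WithTop.add_right_cancel hk_order ((zero_add _).trans h_order)
  refine Hol.order_eq_zero.1 h_zero.symm ?_
  rw [Hol.sub_apply, hf', Hol.one_apply, sub_self]

theorem Hol.eq_zero_of_mul_derivHol_eq_neg (hU : IsPreconnected (U : Set ℂ)) {f k : Hol U}
    {z₀ : U} (hfz : f z₀ = 0) (hf' : derivHol U f z₀ = 1) (h : f * derivHol U k = -k) : k = 0 := by
  have hf0 : f ≠ 0 := fun h0 => by
    rw [h0, map_zero] at hf'
    exact zero_ne_one hf'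
  refine (Hol.eq_zero_or_eq_zero_of_mul hU ?_).resolve_left hf0
  refine Hol.eq_zero_of_bracket_eq_neg hU hfz hf' ?_ (mul_eq_zero_of_left hfz (k z₀))
  rw [derivHol_mul]
  linear_combination f * h

/-- The adjoint action of an even operator on coefficients. -/
def ad (x : Coeff U) : Coeff U →ₗ[ℂ] Coeff U where
  toFun := bracket x
  map_add' y y' := by
    refine Prod.ext ?_ (Prod.ext ?_ ?_) <;>
      simp only [bracket, Prod.fst_add, Prod.snd_add, map_add] <;> ring
  map_smul' c y := by simp [bracket, smul_sub]

theorem exists_mem_bracket_eq_neg (hU : IsPreconnected (U : Set ℂ)) {M : Submodule ℂ (Coeff U)}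
    [FiniteDimensional ℂ M] {x p : Coeff U} {z₀ : U} (hx : ∀ y ∈ M, bracket x y ∈ M)
    (hxz : x.1 z₀ = 0) (hx' : derivHol U x.1 z₀ = 1) (hp : p ∈ M) (hpz : p.1 z₀ ≠ 0) :
    ∃ y ∈ M, y.1 z₀ ≠ 0 ∧ bracket x y = -y := by
  let T : M →ₗ[ℂ] M := (ad x + LinearMap.id).restrict fun y hy => M.add_mem (hx y hy) hy
  -- All vector fields in the image of `ad x + 1` vanish at `z₀`.
  have h_not_surj : ¬ Function.Surjective T := fun h_surj => by
    obtain ⟨y, hy⟩ := h_surj ⟨p, hp⟩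
    have hfst : x.1 * derivHol U (y : Coeff U).1 - (y : Coeff U).1 * derivHol U x.1 +
      (y : Coeff U).1 = p.1 := congrArg (fun q : M => (q : Coeff U).1) hy
    refine hpz ?_
    rw [← hfst, Hol.add_apply, Hol.sub_apply, Hol.mul_apply, Hol.mul_apply, hxz, hx']
    ring
  have h_not_inj := mt LinearMap.injective_iff_surjective.1 h_not_surj
  rw [injective_iff_map_eq_zero] at h_not_inj
  push Not at h_not_inj
  obtain ⟨⟨⟨f, g, h⟩, hyM⟩, hTy, hy0⟩ := h_not_inj
  have hy : bracket x (f, g, h) = -(f, g, h) :=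
    eq_neg_of_add_eq_zero_left (congrArg Subtype.val hTy)
  refine ⟨_, hyM, fun hfz => hy0 (Subtype.ext ?_), hy⟩
  obtain ⟨hf, hg, hh⟩ := by simpa only [bracket, Prod.neg_mk, Prod.mk.injEq] using hy
  obtain rfl : f = 0 := Hol.eq_zero_of_bracket_eq_neg hU hxz hx' hf hfz
  rw [zero_mul, sub_zero] at hg hh
  exact Prod.ext rfl (Prod.ext (Hol.eq_zero_of_mul_derivHol_eq_neg hU hxz hx' hg)
    (Hol.eq_zero_of_mul_derivHol_eq_neg hU hxz hx' hh))

theorem exists_affine_pair (hU : IsPreconnected (U : Set ℂ)) {M : Submodule ℂ (Coeff U)}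
    [FiniteDimensional ℂ M] (hM : ∀ x ∈ M, ∀ y ∈ M, bracket x y ∈ M) {p : Coeff U} {z₀ : U}
    (hp : p ∈ M) (hpz : p.1 z₀ ≠ 0) :
    ∃ x₀ ∈ M, x₀.1 z₀ ≠ 0 ∧ ((∀ x ∈ M, ∃ c : ℂ, x.1 = c • x₀.1) ∨
      ∃ x₁ ∈ M, x₁.1 z₀ = 0 ∧ bracket x₁ x₀ = -x₀) := by
  by_cases h_zero : ∀ x ∈ M, x.1 z₀ = 0 → x.1 = 0
  · refine ⟨p, hp, hpz, Or.inl fun x hx => ⟨x.1 z₀ / p.1 z₀, sub_eq_zero.1 ?_⟩⟩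
    refine h_zero _ (M.sub_mem hx (M.smul_mem _ hp)) ?_
    change x.1 z₀ - x.1 z₀ / p.1 z₀ * p.1 z₀ = 0
    rw [div_mul_cancel₀ _ hpz, sub_self]
  · push Not at h_zero
    obtain ⟨k, hk, hkz, hk0⟩ := h_zero
    obtain ⟨_, ⟨x₁, hx₁, rfl⟩, hx₁z, hx₁'⟩ := exists_mem_derivHol_eq_one hU
      (F := M.map (LinearMap.fst ℂ _ _)) (by
        rintro _ ⟨x, hx, rfl⟩ _ ⟨y, hy, rfl⟩
        exact ⟨_, hM x hx y hy, rfl⟩) ⟨p, hp, rfl⟩ hpz ⟨k, hk, rfl⟩ hkz hk0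
    obtain ⟨x₀, hx₀, hx₀z, h⟩ := exists_mem_bracket_eq_neg hU (hM x₁ hx₁) hx₁z hx₁' hp hpz
    exact ⟨x₀, hx₀, hx₀z, Or.inr ⟨x₁, hx₁, hx₁z, h⟩⟩

end VectorFields

/-! ### Rectification of a vector field -/

section Rectify

variable {U W : Opens ℂ}

theorem exists_local_coordinate (Ψ : Hol U) (z₀ : U) (hΨ : derivHol U Ψ z₀ ≠ 0) :
    ∃ (V : Opens ℂ) (hVU : V ≤ U) (hz : (z₀ : ℂ) ∈ V) (W : Opens ℂ) (r : ℝ) (φ : V ≃ W),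
      0 < r ∧ (W : Set ℂ) = Metric.ball (φ ⟨z₀, hz⟩ : ℂ) r ∧
        (∀ z : V, (φ z : ℂ) = Ψ ⟨z, hVU z.2⟩) ∧ (fun w => (φ.symm w : ℂ)) ∈ holSubalgebra W := by
  let F := extendZero ⇑Ψ
  have hF : AnalyticOnNhd ℂ F U := analyticOnNhd_extendZero Ψ
  let e₀ := ((hF z₀ z₀.2).hasStrictDerivAt.hasStrictFDerivAt_equiv hΨ).toOpenPartialHomeomorph F
  let e := e₀.restrOpen (U ∩ deriv F ⁻¹' {0}ᶜ)
    (hF.deriv.continuousOn.isOpen_inter_preimage U.isOpen isOpen_compl_singleton)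
  have hz₀ : (z₀ : ℂ) ∈ e.source :=
    ⟨HasStrictFDerivAt.mem_toOpenPartialHomeomorph_source _, z₀.2, hΨ⟩
  obtain ⟨r, hr, hrt⟩ := Metric.isOpen_iff.1 e.open_target _ (e.map_source hz₀)
  let V : Opens ℂ := ⟨e.source ∩ e ⁻¹' Metric.ball (e z₀) r,
    e.isOpen_inter_preimage Metric.isOpen_ball⟩
  let W : Opens ℂ := ⟨Metric.ball (e z₀) r, Metric.isOpen_ball⟩
  let φ : V ≃ W :=
    { toFun := fun z => ⟨e z, z.2.2⟩
      invFun := fun w => ⟨e.symm w, e.map_target (hrt w.2), by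
        rw [Set.mem_preimage, e.right_inv (hrt w.2)]
        exact w.2⟩
      left_inv := fun z => Subtype.ext (e.left_inv z.2.1)
      right_inv := fun w => Subtype.ext (e.right_inv (hrt w.2)) }
  refine ⟨V, fun z hz => hz.1.2.1, ⟨hz₀, Metric.mem_ball_self hr⟩, W, r, φ, hr, rfl,
    fun z => extendZero_apply ⇑Ψ ⟨z, z.2.1.2.1⟩, e.symm,
    DifferentiableOn.analyticOnNhd (fun w hw => ?_) W.isOpen, fun _ => rfl⟩
  obtain ⟨-, hzU, hz'⟩ := e.map_target (hrt hw)
  exact (e.hasDerivAt_symm (hrt hw) hz'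
    (hF _ hzU).differentiableAt.hasDerivAt).differentiableAt.differentiableWithinAt

theorem Hol.exists_isUnit_resHol_of_ball (f : Hol U) (z₀ : U) (hf : f z₀ ≠ 0) :
    ∃ (V : Opens ℂ) (hVU : V ≤ U) (r : ℝ), (z₀ : ℂ) ∈ V ∧
      (V : Set ℂ) = Metric.ball (z₀ : ℂ) r ∧ IsUnit (resHol hVU f) := by
  have h_near : ∀ᶠ z in nhds (z₀ : ℂ), z ∈ U ∧ extendZero ⇑f z ≠ 0 := by
    refine (U.isOpen.eventually_mem z₀.2).and
      ((analyticAt_extendZero f z₀).continuousAt.eventually_ne ?_)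
    rwa [extendZero_apply]
  obtain ⟨r, hr, h_ball⟩ := Metric.eventually_nhds_iff_ball.1 h_near
  refine ⟨⟨Metric.ball z₀ r, Metric.isOpen_ball⟩, fun z hz => (h_ball z hz).1, r,
    Metric.mem_ball_self hr, rfl, Hol.isUnit_of_ne_zero fun z hz => (h_ball z z.2).2 ?_⟩
  exact (extendZero_apply ⇑f ⟨z, (h_ball z z.2).1⟩).trans hz

/-- The coordinate is a primitive of `f⁻¹`, and the factors are exponentials of primitives of
`h f⁻¹` and `-g f⁻¹`. -/
theorem exists_transformation_pushCoeff_eq (x : Coeff U) (z₀ : U) (hx : x.1 z₀ ≠ 0) :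
    ∃ (V : Opens ℂ) (hVU : V ≤ U) (hz : (z₀ : ℂ) ∈ V) (W : Opens ℂ) (r : ℝ)
      (τ : Transformation V W), 0 < r ∧ (W : Set ℂ) = Metric.ball 0 r ∧
        (τ.φ ⟨z₀, hz⟩ : ℂ) = 0 ∧ τ.pushCoeff (resCoeff hVU x) = (1, 0, 0) := by
  obtain ⟨f, g, h⟩ := x
  obtain ⟨D, hDU, ρ, hzD, hD, h_unit⟩ := f.exists_isUnit_resHol_of_ball z₀ hx
  obtain ⟨i, hi⟩ := h_unit.exists_right_inv
  obtain ⟨Ψ₀, hΨ₀⟩ := Hol.exists_derivHol_eq_of_ball hD i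
  obtain ⟨P, hP⟩ := Hol.exists_derivHol_eq_of_ball hD (resHol hDU h * i)
  obtain ⟨Q, hQ⟩ := Hol.exists_derivHol_eq_of_ball hD (-(resHol hDU g * i))
  let Ψ : Hol D := Ψ₀ - Ψ₀ ⟨z₀, hzD⟩ • (1 : Hol D)
  have hΨ : derivHol D Ψ = i := by
    rw [map_sub, map_smul, derivHol_one, smul_zero, sub_zero, hΨ₀]
  have hΨ' : derivHol D Ψ ⟨z₀, hzD⟩ ≠ 0 := fun h0 => by
    rw [hΨ] at h0
    have h1 := congrArg (fun k : Hol D => k ⟨z₀, hzD⟩) hi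
    simp only [Hol.mul_apply, h0, mul_zero, Hol.one_apply, zero_ne_one] at h1
  obtain ⟨V, hVD, hz, W, r, φ, hr, hW, hφ, hφ_symm⟩ := exists_local_coordinate Ψ ⟨z₀, hzD⟩ hΨ'
  have hφ0 : (φ ⟨z₀, hz⟩ : ℂ) = 0 := by
    rw [hφ, Hol.sub_apply, Hol.smul_apply, Hol.one_apply, mul_one, sub_self]
  let τ : Transformation V W :=
    ⟨φ, (funext hφ : (fun z => (φ z : ℂ)) = resHol hVD Ψ) ▸ (resHol hVD Ψ).2, hφ_symm,
      (resHol hVD P).isUnit_cexp.unit, (resHol hVD Q).isUnit_cexp.unit⟩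
  have hτ : τ.newCoord = resHol hVD Ψ := Hol.ext hφ
  refine ⟨V, hVD.trans hDU, hz, W, r, τ, hr, hφ0 ▸ hW, hφ0, ?_⟩
  have hV : resHol hVD (resHol hDU f) * resHol hVD i = 1 := congrArg (resHol hVD) hi
  refine (τ.pushCoeff_apply (resHol hVD (resHol hDU f)) (resHol hVD (resHol hDU g))
    (resHol hVD (resHol hDU h))).trans (Prod.ext ?_
      (Prod.ext (τ.compEquiv.map_eq_zero_iff.2 ?_) (τ.compEquiv.map_eq_zero_iff.2 ?_)))
  · rw [hτ, derivHol_resHol, hΨ]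
    exact congrArg τ.compEquiv hV
  · rw [logDerivHol_cexp, derivHol_resHol, hQ, map_neg, resHol_mul]
    linear_combination (-resHol hVD (resHol hDU g)) * hV
  · rw [logDerivHol_cexp, derivHol_resHol, hP, resHol_mul]
    linear_combination (-resHol hVD (resHol hDU h)) * hV

theorem exists_eq_of_bracket_dz_eq_neg (hW : IsPreconnected (W : Set ℂ)) {z₀ : W}
    (hz₀ : (z₀ : ℂ) = 0) {x : Coeff W} (hxz : x.1 z₀ = 0)
    (hx : bracket x (1, 0, 0) = -(1, 0, 0)) :
    ∃ α β : ℂ, x = (coord W, α • 1, β • 1) := by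
  obtain ⟨f, g, h⟩ := x
  simp only [bracket, derivHol_one, map_zero, mul_zero, one_mul, zero_sub, Prod.neg_mk,
    Prod.mk.injEq, neg_inj] at hx
  obtain ⟨hf, hg, hh⟩ := hx
  obtain ⟨α, rfl⟩ := Hol.exists_eq_smul_one_of_derivHol_eq_zero hW hg
  obtain ⟨β, rfl⟩ := Hol.exists_eq_smul_one_of_derivHol_eq_zero hW hh
  obtain ⟨c, hc⟩ := Hol.exists_eq_smul_one_of_derivHol_eq_zero hW (f := f - coord W)
    (by rw [map_sub, derivHol_coord, hf, sub_self])
  have hc0 : f z₀ - z₀ = c * 1 := congrArg (fun k : Hol W => k z₀) hc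
  rw [hz₀, sub_zero, mul_one, show f z₀ = 0 from hxz] at hc0
  rw [← hc0, zero_smul, sub_eq_zero] at hc
  exact ⟨α, β, by rw [hc]⟩

theorem IsAdmissible.rectify (hU : IsPreconnected (U : Set ℂ)) {M : Submodule ℂ (Coeff U)}
    (hM : IsAdmissible M) {p : Coeff U} {z₀ : U} (hp : p ∈ M) (hpz : p.1 z₀ ≠ 0) :
    ∃ (V : Opens ℂ) (hVU : V ≤ U) (W : Opens ℂ) (r : ℝ) (N : Submodule ℂ (Coeff W)),
      (z₀ : ℂ) ∈ V ∧ 0 < r ∧ (W : Set ℂ) = Metric.ball 0 r ∧ IsAdmissible N ∧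
        Equivalent (restrictOps hVU (M.map (evenMap U))) (N.map (evenMap W)) ∧
        (1, 0, 0) ∈ N ∧ ((∀ x ∈ N, ∃ c : ℂ, x.1 = c • (1 : Hol W)) ∨
          ∃ α β : ℂ, ((coord W, α • 1, β • 1) : Coeff W) ∈ N) := by
  have := hM.finiteDimensional
  obtain ⟨x₀, hx₀, hx₀z, h_pair⟩ := exists_affine_pair hU hM.bracket_mem hp hpz
  obtain ⟨V, hVU, hz, W, r, τ, hr, hW, hφ0, hτ⟩ := exists_transformation_pushCoeff_eq x₀ z₀ hx₀z
  have hW' : IsPreconnected (W : Set ℂ) := hW ▸ (convex_ball _ _).isPreconnected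
  refine ⟨V, hVU, W, r, (M.map (resCoeff hVU)).map τ.pushCoeff, hz, hr, hW,
    (hM.map_resCoeff hU hVU ⟨z₀, hz⟩).map_pushCoeff τ, ?_, ⟨_, ⟨x₀, hx₀, rfl⟩, hτ⟩, ?_⟩
  · rw [restrictOps_map_evenMap]
    exact τ.equivalent_map_pushCoeff _
  refine h_pair.imp ?_ ?_
  · rintro h_prop _ ⟨_, ⟨x, hx, rfl⟩, rfl⟩
    obtain ⟨c, hc⟩ := h_prop x hx
    refine ⟨c, ?_⟩
    rw [← show (τ.pushCoeff (resCoeff hVU x₀)).1 = 1 from congrArg Prod.fst hτ]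
    change τ.compEquiv (resHol hVU x.1 * _) = c • τ.compEquiv (resHol hVU x₀.1 * _)
    rw [hc, map_smul, smul_mul_assoc, map_smul]
  · rintro ⟨x₁, hx₁, hx₁z, h_bracket⟩
    have hx₁φ : (τ.pushCoeff (resCoeff hVU x₁)).1 (τ.φ ⟨z₀, hz⟩) = 0 := by
      change resHol hVU x₁.1 (τ.φ.symm (τ.φ ⟨z₀, hz⟩)) * _ = 0
      rw [τ.φ.symm_apply_apply]
      exact mul_eq_zero_of_left hx₁z _
    obtain ⟨α, β, h⟩ := exists_eq_of_bracket_dz_eq_neg hW' hφ0 hx₁φ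
      (by rw [← hτ, ← τ.bracket_pushCoeff, ← resCoeff_bracket, h_bracket, map_neg, map_neg])
    exact ⟨α, β, h ▸ ⟨_, ⟨x₁, hx₁, rfl⟩, rfl⟩⟩

end Rectify

/-! ### Finite-dimensional function spaces stable under differentiation -/

section Stable

variable {K E : Type*} [Field K] [AddCommGroup E] [Module K E]

theorem isNilpotent_of_commutator [CharZero K] [FiniteDimensional K E] {A D : Module.End K E}
    (h : A * D - D * A = -D) : IsNilpotent D := by
  by_contra hn
  have commutator_pow (k : ℕ) : A * D ^ k - D ^ k * A = (-(k : K)) • D ^ k := by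
    induction k with
    | zero => simp
    | succ k ih =>
      calc A * D ^ (k + 1) - D ^ (k + 1) * A
          = (A * D ^ k - D ^ k * A) * D + D ^ k * (A * D - D * A) := by noncomm_ring
        _ = (-((k + 1 : ℕ) : K)) • D ^ (k + 1) := by
          rw [ih, h, smul_mul_assoc, mul_neg, ← pow_succ]
          push_cast
          module
  let T : Module.End K (Module.End K E) := LinearMap.mulLeft K A - LinearMap.mulRight K A
  have hasEigenvalue (k : ℕ) : T.HasEigenvalue (-(k : K)) :=
    Module.End.hasEigenvalue_of_hasEigenvector (x := D ^ k)
      ⟨Module.End.mem_eigenspace_iff.2 (commutator_pow k), fun h0 => hn ⟨k, h0⟩⟩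
  exact Set.infinite_of_injective_forall_mem (neg_injective.comp Nat.cast_injective) hasEigenvalue
    T.finite_hasEigenvalue

theorem iSup_inf_maxGenEigenspace_eq [IsAlgClosed K] {T : Module.End K E} {P : Submodule K E}
    [FiniteDimensional K P] (hT : ∀ k ∈ P, T k ∈ P) : ⨆ σ, P ⊓ T.maxGenEigenspace σ = P := by
  have h := congrArg (Submodule.map P.subtype)
    (Module.End.iSup_maxGenEigenspace_eq_top (T.restrict hT))
  simpa only [Submodule.map_iSup, Module.End.maxGenEigenspace, Module.End.genEigenspace_restrict,
    Submodule.map_comap_subtype, Submodule.map_subtype_top] using h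

theorem finite_inf_maxGenEigenspace_ne_bot {T : Module.End K E} {P : Submodule K E}
    [FiniteDimensional K P] (hT : ∀ k ∈ P, T k ∈ P) :
    {σ | P ⊓ T.maxGenEigenspace σ ≠ ⊥}.Finite := by
  refine (Module.End.finite_hasEigenvalue (T.restrict hT)).subset fun σ hσ => ?_
  have h : Module.End.HasUnifEigenvalue (T.restrict hT) σ ⊤ := fun h => hσ <| by
    rw [← Submodule.map_comap_subtype, Module.End.maxGenEigenspace,
      ← Module.End.genEigenspace_restrict T P ⊤ σ hT, h, Submodule.map_bot]
  exact h.lt zero_lt_one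

variable {U : Opens ℂ}

/-- The polynomials of degree less than `n` in the coordinate. -/
def polySpace (U : Opens ℂ) (n : ℕ) : Submodule ℂ (Hol U) :=
  Submodule.span ℂ (Set.range fun l : Fin n => coord U ^ (l : ℕ))

theorem coord_pow_mem_polySpace {l n : ℕ} (h : l < n) : coord U ^ l ∈ polySpace U n :=
  Submodule.subset_span ⟨⟨l, h⟩, rfl⟩

theorem exists_derivHol_eq_of_mem_polySpace {n : ℕ} {k : Hol U} (hk : k ∈ polySpace U n) :
    ∃ P ∈ polySpace U (n + 1), derivHol U P = k := by
  suffices polySpace U n ≤ (polySpace U (n + 1)).map (derivHol U) from this hk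
  refine Submodule.span_le.2 ?_
  rintro _ ⟨l, rfl⟩
  refine ⟨((l + 1 : ℕ) : ℂ)⁻¹ • coord U ^ ((l : ℕ) + 1),
    Submodule.smul_mem _ _ (coord_pow_mem_polySpace (by lia)), ?_⟩
  rw [map_smul, derivHol_coord_pow, inv_smul_smul₀ (Nat.cast_ne_zero.2 l.1.succ_ne_zero),
    Nat.add_sub_cancel]

theorem derivHol_pow_coord_pow_eq_zero {m l : ℕ} (h : l < m) :
    (derivHol U ^ m) (coord U ^ l) = 0 := by
  induction m generalizing l with
  | zero => lia
  | succ m ih =>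
    rw [pow_succ, Module.End.mul_apply, derivHol_coord_pow, map_smul]
    obtain rfl | hl := Nat.eq_zero_or_pos l
    · rw [Nat.cast_zero, zero_smul]
    · rw [ih (by lia), smul_zero]

theorem mem_polySpace_iff (hU : IsPreconnected (U : Set ℂ)) {n : ℕ} {k : Hol U} :
    k ∈ polySpace U n ↔ (derivHol U ^ n) k = 0 := by
  constructor
  · suffices polySpace U n ≤ LinearMap.ker (derivHol U ^ n) from fun h => this h
    refine Submodule.span_le.2 ?_
    rintro _ ⟨l, rfl⟩
    exact derivHol_pow_coord_pow_eq_zero l.2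
  · intro h
    induction n generalizing k with
    | zero =>
      obtain rfl : k = 0 := h
      exact zero_mem _
    | succ n ih =>
      rw [pow_succ, Module.End.mul_apply] at h
      obtain ⟨P, hP, hPk⟩ := exists_derivHol_eq_of_mem_polySpace (ih h)
      obtain ⟨c, hc⟩ := Hol.exists_eq_smul_one_of_derivHol_eq_zero hU (f := k - P)
        (by rw [map_sub, hPk, sub_self])
      rw [← sub_add_cancel k P, hc, ← pow_zero (coord U)]
      exact add_mem (Submodule.smul_mem _ _ (coord_pow_mem_polySpace n.succ_pos)) hP

theorem eq_polySpace_of_nilpotent (hU : IsPreconnected (U : Set ℂ)) {P : Submodule ℂ (Hol U)}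
    [FiniteDimensional ℂ P] (hD : ∀ k ∈ P, derivHol U k ∈ P)
    (hnil : ∀ k ∈ P, ∃ m, (derivHol U ^ m) k = 0) : P = polySpace U (Module.finrank ℂ P) := by
  have : FiniteDimensional ℂ (polySpace U (Module.finrank ℂ P)) :=
    FiniteDimensional.span_of_finite ℂ (Set.finite_range _)
  refine Submodule.eq_of_le_of_finrank_le (fun k hk => ?_)
    ((finrank_range_le_card _).trans_eq (Fintype.card_fin _))
  have restrict_pow (n : ℕ) :
      (((derivHol U).restrict hD ^ n) ⟨k, hk⟩ : Hol U) = (derivHol U ^ n) k := by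
    rw [Module.End.pow_restrict n]
    rfl
  obtain ⟨m, hm⟩ := hnil k hk
  have h_ker : (⟨k, hk⟩ : P) ∈ LinearMap.ker ((derivHol U).restrict hD ^ m) :=
    Subtype.ext ((restrict_pow m).trans hm)
  rw [mem_polySpace_iff hU, ← restrict_pow]
  exact congrArg Subtype.val (Module.End.ker_pow_le_ker_pow_finrank _ m h_ker)

theorem eq_polySpace_of_euler (hU : IsPreconnected (U : Set ℂ)) {P : Submodule ℂ (Hol U)}
    [FiniteDimensional ℂ P] (hD : ∀ k ∈ P, derivHol U k ∈ P)
    (hE : ∀ k ∈ P, coord U * derivHol U k ∈ P) : P = polySpace U (Module.finrank ℂ P) := by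
  let D : Module.End ℂ P := (derivHol U).restrict hD
  let A : Module.End ℂ P := (LinearMap.mulLeft ℂ (coord U) ∘ₗ derivHol U).restrict hE
  have hAD : A * D - D * A = -D := by
    refine LinearMap.ext fun x => Subtype.ext ?_
    change coord U * derivHol U (derivHol U x) - derivHol U (coord U * derivHol U x) =
      -derivHol U x
    rw [derivHol_mul, derivHol_coord]
    ring
  obtain ⟨m, hm⟩ := isNilpotent_of_commutator hAD
  refine eq_polySpace_of_nilpotent hU hD fun k hk => ⟨m, ?_⟩
  have h : ((D ^ m) ⟨k, hk⟩ : Hol U) = 0 := by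
    rw [hm]
    rfl
  rwa [Module.End.pow_restrict m] at h

theorem derivHol_sub_smul_pow_expFun_mul (σ : ℂ) (m : ℕ) (k : Hol U) :
    ((derivHol U - σ • (1 : Module.End ℂ (Hol U))) ^ m) (expFun U σ * k) =
      expFun U σ * (derivHol U ^ m) k := by
  induction m generalizing k with
  | zero => rfl
  | succ m ih =>
    rw [pow_succ, pow_succ, Module.End.mul_apply, Module.End.mul_apply, ← ih, LinearMap.sub_apply,
      LinearMap.smul_apply, Module.End.one_apply, derivHol_mul, derivHol_expFun, smul_mul_assoc,
      add_sub_cancel_left]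

theorem exists_inf_maxGenEigenspace_eq_span (hU : IsPreconnected (U : Set ℂ))
    {P : Submodule ℂ (Hol U)} [FiniteDimensional ℂ P] (hD : ∀ k ∈ P, derivHol U k ∈ P) (σ : ℂ) :
    ∃ n : ℕ, P ⊓ Module.End.maxGenEigenspace (derivHol U) σ =
      Submodule.span ℂ (Set.range fun l : Fin n => coord U ^ (l : ℕ) * expFun U σ) := by
  let e : Hol U ≃ₗ[ℂ] Hol U :=
    DistribMulAction.toLinearEquiv ℂ (Hol U) (isUnit_expFun (U := U) σ).unit
  have e_apply (k : Hol U) : e k = expFun U σ * k := rfl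
  let Q : Submodule ℂ (Hol U) :=
    (P ⊓ Module.End.maxGenEigenspace (derivHol U) σ).comap e.toLinearMap
  have : FiniteDimensional ℂ Q := by
    rw [show Q = _ from Submodule.comap_equiv_eq_map_symm e _]
    infer_instance
  have hQ : Q = polySpace U (Module.finrank ℂ Q) := by
    refine eq_polySpace_of_nilpotent hU ?_ ?_
    · rintro k ⟨hkP, hk⟩
      have he : e (derivHol U k) = derivHol U (e k) - σ • e k := by
        rw [e_apply, e_apply, derivHol_mul, derivHol_expFun, smul_mul_assoc, add_sub_cancel_left]
      refine Submodule.mem_comap.2 (he ▸ sub_mem ⟨hD _ hkP, ?_⟩ (Submodule.smul_mem _ _ ⟨hkP, hk⟩))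
      exact Module.End.mapsTo_maxGenEigenspace_of_comm (Commute.refl _) σ hk
    · rintro k ⟨-, hk⟩
      obtain ⟨m, hm⟩ := (Module.End.mem_maxGenEigenspace _ _ _).1 hk
      refine ⟨m, e.injective ?_⟩
      rw [map_zero, e_apply, ← derivHol_sub_smul_pow_expFun_mul]
      exact hm
  refine ⟨Module.finrank ℂ Q, ?_⟩
  rw [← Submodule.map_comap_eq_of_surjective e.surjective (P ⊓ _)]
  change Q.map _ = _
  rw [hQ, polySpace, Submodule.map_span, ← Set.range_comp, ← polySpace, ← hQ]
  exact congrArg _ (congrArg _ (funext fun l => mul_comm _ _))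

/-- The exponential polynomials spanned by `z^l e^(σz)` with `σ ∈ S` and `l ≤ s σ`. -/
def expPolySpace (U : Opens ℂ) (S : Finset ℂ) (s : ℂ → ℕ) : Submodule ℂ (Hol U) :=
  Submodule.span ℂ {k | ∃ σ ∈ S, ∃ l ≤ s σ, k = coord U ^ l * expFun U σ}

theorem coord_pow_mul_expFun_mem_expPolySpace {S : Finset ℂ} {s : ℂ → ℕ} {σ : ℂ} (hσ : σ ∈ S)
    {l : ℕ} (hl : l ≤ s σ) : coord U ^ l * expFun U σ ∈ expPolySpace U S s :=
  Submodule.subset_span ⟨σ, hσ, l, hl, rfl⟩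

theorem exists_eq_expPolySpace (hU : IsPreconnected (U : Set ℂ)) {P : Submodule ℂ (Hol U)}
    [FiniteDimensional ℂ P] (hD : ∀ k ∈ P, derivHol U k ∈ P) :
    ∃ (S : Finset ℂ) (s : ℂ → ℕ), P = expPolySpace U S s := by
  choose n hn using exists_inf_maxGenEigenspace_eq_span hU hD
  have h_finite := finite_inf_maxGenEigenspace_ne_bot hD
  have n_pos {σ : ℂ} (hσ : σ ∈ h_finite.toFinset) : 0 < n σ := by
    rw [Set.Finite.mem_toFinset] at hσ
    by_contra! h0
    have : IsEmpty (Fin (n σ)) := by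
      rw [Nat.le_zero.1 h0]
      infer_instance
    exact hσ (by rw [hn, Set.range_eq_empty, Submodule.span_empty])
  refine ⟨h_finite.toFinset, fun σ => n σ - 1, ?_⟩
  refine (iSup_inf_maxGenEigenspace_eq hD).symm.trans
    (le_antisymm (iSup_le fun σ => ?_) (Submodule.span_le.2 ?_))
  · by_cases hσ : P ⊓ Module.End.maxGenEigenspace (derivHol U) σ = ⊥
    · exact hσ.trans_le bot_le
    · rw [hn σ]
      refine Submodule.span_le.2 ?_
      rintro _ ⟨l, rfl⟩
      exact coord_pow_mul_expFun_mem_expPolySpace (h_finite.mem_toFinset.2 hσ)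
        (Nat.le_pred_of_lt l.2)
  · rintro _ ⟨σ, hσ, l, hl, rfl⟩
    refine Submodule.mem_iSup_of_mem σ ?_
    rw [hn σ]
    exact Submodule.subset_span ⟨⟨l, (Nat.lt_iff_le_pred (n_pos hσ)).2 hl⟩, rfl⟩

theorem exists_derivHol_eq_coord_pow_mul_expFun {H : Submodule ℂ (Hol U)} {σ : ℂ} (hσ : σ ≠ 0)
    {l : ℕ} (h : ∀ j ≤ l, coord U ^ j * expFun U σ ∈ H) :
    ∃ P ∈ H, derivHol U P = coord U ^ l * expFun U σ := by
  induction l with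
  | zero =>
    refine ⟨σ⁻¹ • (coord U ^ 0 * expFun U σ), H.smul_mem _ (h 0 le_rfl), ?_⟩
    rw [pow_zero, one_mul, map_smul, derivHol_expFun, inv_smul_smul₀ hσ]
  | succ l ih =>
    obtain ⟨P, hP, hPl⟩ := ih fun j hj => h j (hj.trans l.le_succ)
    refine ⟨σ⁻¹ • (coord U ^ (l + 1) * expFun U σ - ((l + 1 : ℕ) : ℂ) • P),
      H.smul_mem _ (H.sub_mem (h _ le_rfl) (H.smul_mem _ hP)), ?_⟩
    rw [map_smul, map_sub, derivHol_mul, derivHol_coord_pow, derivHol_expFun, map_smul, hPl,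
      Nat.add_sub_cancel, smul_mul_assoc, add_sub_cancel_left, mul_smul_comm, inv_smul_smul₀ hσ]

/-- The least exponent `N` such that `z^N` is not one of the spanning functions `z^l e^(σz)` of
`expPolySpace`. -/
def firstMissingPower (S : Finset ℂ) (s : ℂ → ℕ) : ℕ := if (0 : ℂ) ∈ S then s 0 + 1 else 0

theorem coord_pow_mem_expPolySpace {S : Finset ℂ} {s : ℂ → ℕ} {l : ℕ}
    (hl : l < firstMissingPower S s) : coord U ^ l ∈ expPolySpace U S s := by
  rw [firstMissingPower] at hl
  split_ifs at hl with h0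
  · rw [← mul_one (coord U ^ l), ← expFun_zero]
    exact coord_pow_mul_expFun_mem_expPolySpace h0 (Nat.le_of_lt_succ hl)
  · exact absurd hl l.not_lt_zero

theorem coord_pow_mem_expPolySpace_sup {S : Finset ℂ} {s : ℂ → ℕ} {l : ℕ}
    (hl : l ≤ firstMissingPower S s) : coord U ^ l ∈
      expPolySpace U S s ⊔ Submodule.span ℂ {coord U ^ firstMissingPower S s} := by
  obtain hl | rfl := hl.lt_or_eq
  · exact Submodule.mem_sup_left (coord_pow_mem_expPolySpace hl)
  · exact Submodule.mem_sup_right (Submodule.mem_span_singleton_self _)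

theorem exists_derivHol_eq_of_mem_expPolySpace {S : Finset ℂ} {s : ℂ → ℕ} {k : Hol U}
    (hk : k ∈ expPolySpace U S s) :
    ∃ P ∈ expPolySpace U S s ⊔ Submodule.span ℂ {coord U ^ firstMissingPower S s},
      derivHol U P = k := by
  let K := expPolySpace U S s ⊔ Submodule.span ℂ {coord U ^ firstMissingPower S s}
  suffices expPolySpace U S s ≤ K.map (derivHol U) from this hk
  refine Submodule.span_le.2 ?_
  rintro _ ⟨σ, hσ, l, hl, rfl⟩
  obtain rfl | hσ0 := eq_or_ne σ 0
  · have hlN : l + 1 ≤ firstMissingPower S s := by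
      rw [firstMissingPower, if_pos hσ]
      exact Nat.succ_le_succ hl
    refine ⟨((l + 1 : ℕ) : ℂ)⁻¹ • coord U ^ (l + 1),
      K.smul_mem _ (coord_pow_mem_expPolySpace_sup hlN), ?_⟩
    rw [map_smul, derivHol_coord_pow, inv_smul_smul₀ (Nat.cast_ne_zero.2 l.succ_ne_zero),
      Nat.add_sub_cancel, expFun_zero, mul_one]
  · obtain ⟨P, hP, hPl⟩ := exists_derivHol_eq_coord_pow_mul_expFun hσ0 fun j hj =>
      coord_pow_mul_expFun_mem_expPolySpace (U := U) hσ (hj.trans hl)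
    exact ⟨P, Submodule.mem_sup_left hP, hPl⟩

theorem exists_sub_smul_coord_pow_mem_expPolySpace (hU : IsPreconnected (U : Set ℂ))
    {S : Finset ℂ} {s : ℂ → ℕ} {k : Hol U} (hk : derivHol U k ∈ expPolySpace U S s) :
    ∃ α : ℂ, k - α • coord U ^ firstMissingPower S s ∈ expPolySpace U S s := by
  obtain ⟨P, hP, hPk⟩ := exists_derivHol_eq_of_mem_expPolySpace hk
  obtain ⟨c, hc⟩ := Hol.exists_eq_smul_one_of_derivHol_eq_zero hU (f := k - P)
    (by rw [map_sub, hPk, sub_self])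
  have hkP := Submodule.add_mem _
    (Submodule.smul_mem _ c (coord_pow_mem_expPolySpace_sup (firstMissingPower S s).zero_le)) hP
  rw [pow_zero, ← hc, sub_add_cancel, Submodule.mem_sup] at hkP
  obtain ⟨a, ha, _, hb, rfl⟩ := hkP
  obtain ⟨α, rfl⟩ := Submodule.mem_span_singleton.1 hb
  exact ⟨α, by rwa [add_sub_cancel_right]⟩

end Stable

/-! ### Vector fields and operators without `∂_z` term -/

section Vertical

theorem eq_span_sup_inf_ker {K E F : Type*} [Ring K] [AddCommGroup E] [Module K E]
    [AddCommGroup F] [Module K F] {f : E →ₗ[K] F} {M : Submodule K E} {T : Set E} (hT : T ⊆ M)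
    (h : M.map f ≤ Submodule.span K (f '' T)) : M = Submodule.span K T ⊔ M ⊓ LinearMap.ker f := by
  refine le_antisymm (fun x hx => ?_) (sup_le (Submodule.span_le.2 hT) inf_le_left)
  rw [← Submodule.map_span] at h
  obtain ⟨y, hy, hyx⟩ := h ⟨x, hx, rfl⟩
  rw [← add_sub_cancel y x]
  refine Submodule.add_mem_sup hy ⟨M.sub_mem hx (Submodule.span_le.2 hT hy), ?_⟩
  change f (x - y) = 0
  rw [map_sub, hyx, sub_self]

theorem span_singleton_sup_eq_of_sub_mem {K E : Type*} [Ring K] [AddCommGroup E] [Module K E]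
    {N : Submodule K E} {x y : E} (h : x - y ∈ N) :
    Submodule.span K {x} ⊔ N = Submodule.span K {y} ⊔ N := by
  refine le_antisymm (sup_le ?_ le_sup_right) (sup_le ?_ le_sup_right) <;>
    rw [Submodule.span_singleton_le_iff_mem]
  · rw [← add_sub_cancel y x]
    exact Submodule.add_mem_sup (Submodule.mem_span_singleton_self y) h
  · rw [← sub_sub_cancel x y]
    exact sub_mem (Submodule.mem_sup_left (Submodule.mem_span_singleton_self x))
      (Submodule.mem_sup_right h)

variable {W : Opens ℂ}

/-- The coefficients of the operator of multiplication by a function. -/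
def mulCoeff (W : Opens ℂ) : Hol W →ₗ[ℂ] Coeff W :=
  LinearMap.inr ℂ (Hol W) (Hol W × Hol W) ∘ₗ LinearMap.inr ℂ (Hol W) (Hol W)

theorem evenMap_mulCoeff (h : Hol W) : evenMap W (mulCoeff W h) = mulOp h := by
  change evenOp 0 0 h = _
  rw [evenOp, mulOp_zero, zero_mul, zero_mul, zero_mul, zero_add, zero_add]

theorem evenMap_smul_one (f : Hol W) (c : ℂ) (h : Hol W) :
    evenMap W (f, c • 1, h) = mulOp f * dz W + c • (theta W * dtheta W) + mulOp h := by
  rw [evenMap_apply, evenOp, mulOp_smul, mulOp_one, smul_mul_assoc, one_mul, smul_mul_assoc]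

theorem evenMap_zero_smul_one (c : ℂ) (h : Hol W) :
    evenMap W (0, c • 1, h) = c • (theta W * dtheta W) + mulOp h := by
  rw [evenMap_smul_one, mulOp_zero, zero_mul, zero_add]

theorem evenMap_one_zero_zero : evenMap W (1, 0, 0) = dz W := by
  rw [evenMap_apply, evenOp, mulOp_zero, mulOp_one, one_mul, zero_mul, zero_mul, add_zero, add_zero]

/-- The functions `h` such that the operator of multiplication by `h` belongs to the space. -/
def functionSpace (M : Submodule ℂ (Coeff W)) : Submodule ℂ (Hol W) := M.comap (mulCoeff W)

/-- The operators without `∂_z` term in a space of operators. -/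
def verticalSpace (M : Submodule ℂ (Coeff W)) : Submodule ℂ (Coeff W) :=
  M ⊓ LinearMap.ker (LinearMap.fst ℂ _ _)

theorem mem_functionSpace {M : Submodule ℂ (Coeff W)} {k : Hol W} :
    k ∈ functionSpace M ↔ ((0, 0, k) : Coeff W) ∈ M := Iff.rfl

theorem IsAdmissible.finiteDimensional_functionSpace {M : Submodule ℂ (Coeff W)}
    (hM : IsAdmissible M) : FiniteDimensional ℂ (functionSpace M) := by
  have := hM.finiteDimensional
  have h_inj : Function.Injective (mulCoeff W) :=
    LinearMap.inr_injective.comp LinearMap.inr_injective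
  exact Module.Finite.of_injective ((mulCoeff W).restrict (p := functionSpace M) fun _ hk => hk)
    fun _ _ h => Subtype.ext (h_inj (congrArg Subtype.val h))

theorem IsAdmissible.mul_derivHol_mem_functionSpace {M : Submodule ℂ (Coeff W)}
    (hM : IsAdmissible M) {x : Coeff W} (hx : x ∈ M) {g k : Hol W} (hk : (0, g, k) ∈ M) :
    x.1 * derivHol W k ∈ functionSpace M := by
  obtain ⟨c, rfl⟩ := hM.exists_eq_smul_one g k hk
  have h := hM.bracket_mem x hx _ hk
  rw [mem_functionSpace]
  simpa only [bracket, map_smul, derivHol_one, map_zero, smul_zero, mul_zero, zero_mul, sub_zero]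
    using h

theorem IsAdmissible.derivHol_mem_functionSpace {M : Submodule ℂ (Coeff W)}
    (hM : IsAdmissible M) (h1 : (1, 0, 0) ∈ M) {g k : Hol W} (hk : (0, g, k) ∈ M) :
    derivHol W k ∈ functionSpace M :=
  one_mul (derivHol W k) ▸ hM.mul_derivHol_mem_functionSpace h1 hk

theorem verticalSpace_eq_of_mem {M : Submodule ℂ (Coeff W)} {ε : ℂ} {h₁ : Hol W}
    (h_mem : (0, ε • 1, h₁) ∈ M) (h : ∀ g k, ((0, g, k) : Coeff W) ∈ M → ∃ c : ℂ, g = c • ε • 1) :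
    verticalSpace M = Submodule.span ℂ {(0, ε • 1, h₁)} ⊔ (functionSpace M).map (mulCoeff W) := by
  have h_ker : verticalSpace M ⊓ LinearMap.ker (LinearMap.fst ℂ _ _ ∘ₗ LinearMap.snd ℂ (Hol W) _) =
      (functionSpace M).map (mulCoeff W) := by
    ext ⟨f, g, k⟩
    constructor
    · rintro ⟨⟨hx, rfl : f = 0⟩, rfl : g = 0⟩
      exact ⟨k, hx, rfl⟩
    · rintro ⟨k', hk, h⟩
      cases h
      exact ⟨⟨hk, rfl⟩, rfl⟩
  rw [← h_ker]
  refine eq_span_sup_inf_ker (Set.singleton_subset_iff.2 ⟨h_mem, rfl⟩) ?_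
  rintro _ ⟨⟨f, g, k⟩, ⟨hx, rfl : f = 0⟩, rfl⟩
  obtain ⟨c, hc⟩ := h g k hx
  rw [Set.image_singleton]
  exact Submodule.mem_span_singleton.2 ⟨c, hc.symm⟩

theorem IsAdmissible.exists_generator {M : Submodule ℂ (Coeff W)} (hM : IsAdmissible M) :
    ∃ (ε : ℂ) (h₁ : Hol W), (ε = 0 ∨ ε = 1) ∧ (ε = 0 → h₁ = 0) ∧ (0, ε • 1, h₁) ∈ M ∧
      verticalSpace M =
        Submodule.span ℂ {(0, ε • 1, h₁)} ⊔ (functionSpace M).map (mulCoeff W) := by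
  by_cases h0 : ∀ g h, ((0, g, h) : Coeff W) ∈ M → g = 0
  · have h_mem : ((0, (0 : ℂ) • 1, 0) : Coeff W) ∈ M := by
      rw [zero_smul]
      exact M.zero_mem
    exact ⟨0, 0, Or.inl rfl, fun _ => rfl, h_mem, verticalSpace_eq_of_mem h_mem fun g k hk =>
      ⟨0, by rw [h0 g k hk, zero_smul]⟩⟩
  · push Not at h0
    obtain ⟨_, h₁, hx, hne⟩ := h0
    obtain ⟨a, rfl⟩ := hM.exists_eq_smul_one _ h₁ hx
    have ha : a ≠ 0 := fun h => hne (by rw [h, zero_smul])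
    have h_mem : (0, (1 : ℂ) • 1, a⁻¹ • h₁) ∈ M := by
      simpa only [Prod.smul_mk, smul_zero, smul_smul, inv_mul_cancel₀ ha] using M.smul_mem a⁻¹ hx
    refine ⟨1, _, Or.inr rfl, fun h => absurd h one_ne_zero, h_mem,
      verticalSpace_eq_of_mem h_mem fun g k hk => ?_⟩
    rw [one_smul]
    exact hM.exists_eq_smul_one g k hk

theorem verticalSpace_eq_of_sub_mem {M : Submodule ℂ (Coeff W)} {ε : ℂ} {h₁ h₂ : Hol W}
    (hv : verticalSpace M =
      Submodule.span ℂ {(0, ε • 1, h₁)} ⊔ (functionSpace M).map (mulCoeff W))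
    (h : h₁ - h₂ ∈ functionSpace M) :
    verticalSpace M =
      Submodule.span ℂ {(0, ε • 1, h₂)} ⊔ (functionSpace M).map (mulCoeff W) := by
  refine hv.trans (span_singleton_sup_eq_of_sub_mem ⟨_, h, ?_⟩)
  rw [Prod.mk_sub_mk, Prod.mk_sub_mk, sub_self, sub_self]
  rfl

theorem map_evenMap_eq_span {M : Submodule ℂ (Coeff W)} {T : Set (Coeff W)} {v : Coeff W}
    {S : Set (Hol W)} (hT : T ⊆ M)
    (hfst : M.map (LinearMap.fst ℂ _ _) ≤ Submodule.span ℂ (Prod.fst '' T))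
    (hv : verticalSpace M = Submodule.span ℂ {v} ⊔ (Submodule.span ℂ S).map (mulCoeff W)) :
    M.map (evenMap W) =
      Submodule.span ℂ (evenMap W '' T ∪ ({evenMap W v} ∪ mulOp '' S)) := by
  conv_lhs => rw [eq_span_sup_inf_ker hT hfst, ← verticalSpace, hv]
  simp only [Submodule.map_sup, Submodule.map_span, Set.image_image, Set.image_singleton,
    evenMap_mulCoeff, Submodule.span_union]

end Vertical

/-! ### Algebras with at most one vector field -/

section OneVectorField

variable {W : Opens ℂ} {M : Submodule ℂ (Coeff W)}

theorem IsAdmissible.isType0 (hM : IsAdmissible M) (hf : ∀ x ∈ M, x.1 = 0) :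
    IsType0 (M.map (evenMap W)) := by
  obtain ⟨ε, h₁, hε, -, -, hv⟩ := hM.exists_generator
  have := hM.finiteDimensional_functionSpace
  let b := Module.finBasis ℂ (functionSpace M)
  have hb : Submodule.span ℂ (Set.range ((functionSpace M).subtype ∘ b)) = functionSpace M := by
    rw [Set.range_comp, ← Submodule.map_span, b.span_eq, Submodule.map_subtype_top]
  have hfst : M.map (LinearMap.fst ℂ _ _) ≤ Submodule.span ℂ (Prod.fst '' (∅ : Set (Coeff W))) := by
    rintro _ ⟨x, hx, rfl⟩
    rw [LinearMap.fst_apply, hf x hx]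
    exact zero_mem _
  rw [← hb] at hv
  refine ⟨ε, h₁, _, (functionSpace M).subtype ∘ b, hε,
    b.linearIndependent.map' _ (Submodule.ker_subtype _), ?_⟩
  rw [map_evenMap_eq_span (Set.empty_subset _) hfst hv, Set.image_empty, Set.empty_union,
    evenMap_zero_smul_one, ← Set.range_comp]
  rfl

theorem IsAdmissible.isType1 (hW : IsPreconnected (W : Set ℂ)) (hM : IsAdmissible M)
    (h1 : (1, 0, 0) ∈ M) (hf : ∀ x ∈ M, ∃ c : ℂ, x.1 = c • (1 : Hol W)) :
    IsType1 (M.map (evenMap W)) := by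
  obtain ⟨ε, h₁, hε, hε0, h_mem, hv⟩ := hM.exists_generator
  have := hM.finiteDimensional_functionSpace
  obtain ⟨S, s, hS⟩ := exists_eq_expPolySpace hW (P := functionSpace M)
    fun k hk => hM.derivHol_mem_functionSpace h1 hk
  obtain ⟨α, hα0, hα⟩ : ∃ α : ℂ, (ε = 0 → α = 0) ∧
      h₁ - α • coord W ^ firstMissingPower S s ∈ functionSpace M := by
    by_cases h0 : ε = 0
    · refine ⟨0, fun _ => rfl, ?_⟩
      rw [hε0 h0, zero_smul, sub_zero]
      exact zero_mem _
    · have h_deriv := hM.derivHol_mem_functionSpace h1 h_mem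
      rw [hS] at h_deriv ⊢
      obtain ⟨α, hα⟩ := exists_sub_smul_coord_pow_mem_expPolySpace hW h_deriv
      exact ⟨α, fun h => absurd h h0, hα⟩
  have hfst : M.map (LinearMap.fst ℂ _ _) ≤
      Submodule.span ℂ (Prod.fst '' ({(1, 0, 0)} : Set (Coeff W))) := by
    rintro _ ⟨x, hx, rfl⟩
    obtain ⟨c, hc⟩ := hf x hx
    rw [Set.image_singleton]
    exact Submodule.mem_span_singleton.2 ⟨c, hc.symm⟩
  have hv' := verticalSpace_eq_of_sub_mem hv hα
  rw [hS, expPolySpace] at hv'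
  refine ⟨ε, α, S, s, hε, hα0, ?_⟩
  rw [map_evenMap_eq_span (Set.singleton_subset_iff.2 h1) hfst hv', Set.image_singleton,
    evenMap_one_zero_zero, evenMap_zero_smul_one, mulOp_smul, ← Set.union_assoc,
    Set.singleton_union]
  congr 2
  ext T
  constructor
  · rintro ⟨_, ⟨σ, hσ, l, hl, rfl⟩, rfl⟩
    exact ⟨σ, hσ, l, hl, rfl⟩
  · rintro ⟨σ, hσ, l, hl, rfl⟩
    exact ⟨_, ⟨σ, hσ, l, hl, rfl⟩, rfl⟩

end OneVectorField

/-! ### Algebras containing `∂_z` and `z∂_z + αθ∂_θ + β` -/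

section PolynomialForms

variable {W : Opens ℂ}

theorem derivHol_pow_coord_pow_self (n : ℕ) :
    (derivHol W ^ n) (coord W ^ n) = (n.factorial : ℂ) • (1 : Hol W) := by
  induction n with
  | zero =>
    rw [pow_zero, pow_zero, Module.End.one_apply, Nat.factorial_zero, Nat.cast_one, one_smul]
  | succ n ih =>
    rw [pow_succ, Module.End.mul_apply, derivHol_coord_pow, map_smul, Nat.add_sub_cancel, ih,
      smul_smul, Nat.factorial_succ, Nat.cast_mul]

theorem polySpace_mono {m n : ℕ} (h : m ≤ n) : polySpace W m ≤ polySpace W n :=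
  Submodule.span_le.2 fun _ ⟨l, hl⟩ => hl ▸ coord_pow_mem_polySpace (l.2.trans_le h)

theorem polySpace_zero : polySpace W 0 = ⊥ := by
  rw [polySpace, Set.range_eq_empty, Submodule.span_empty]

theorem polySpace_one : polySpace W 1 = Submodule.span ℂ {1} := by
  rw [polySpace, Set.range_unique, Fin.default_eq_zero, Fin.val_zero, pow_zero]

theorem lt_of_coord_pow_mem_polySpace (hW : IsConnected (W : Set ℂ)) {m n : ℕ}
    (h : coord W ^ m ∈ polySpace W n) : m < n := by
  by_contra! h_le
  have h_deriv := (mem_polySpace_iff hW.isPreconnected).1 (polySpace_mono h_le h)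
  rw [derivHol_pow_coord_pow_self] at h_deriv
  obtain ⟨z, hz⟩ := hW.nonempty
  have h_val : (m.factorial : ℂ) * 1 = 0 := congrArg (fun k : Hol W => k ⟨z, hz⟩) h_deriv
  exact Nat.factorial_ne_zero m (by exact_mod_cast (mul_one (m.factorial : ℂ)).symm.trans h_val)

theorem derivHol_pow_succ_coord_mul (n : ℕ) (k : Hol W) :
    (derivHol W ^ (n + 1)) (coord W * k) =
      coord W * (derivHol W ^ (n + 1)) k + ((n : ℂ) + 1) • (derivHol W ^ n) k := by
  induction n generalizing k with
  | zero =>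
    rw [zero_add, pow_one, pow_zero, Module.End.one_apply, derivHol_mul, derivHol_coord,
      Nat.cast_zero, zero_add, one_smul, one_mul, add_comm]
  | succ n ih =>
    rw [pow_succ, Module.End.mul_apply, derivHol_mul, derivHol_coord, one_mul, map_add, ih,
      ← Module.End.mul_apply, ← Module.End.mul_apply, ← pow_succ, ← pow_succ, Nat.cast_succ]
    module

theorem exists_sub_smul_one_mem_polySpace (hW : IsPreconnected (W : Set ℂ)) {n : ℕ} {k : Hol W}
    (hD : derivHol W k ∈ polySpace W n) (hE : coord W * derivHol W k ∈ polySpace W n) :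
    ∃ γ : ℂ, k - γ • (1 : Hol W) ∈ polySpace W n := by
  cases n with
  | zero =>
    rw [polySpace_zero, Submodule.mem_bot] at hD
    obtain ⟨γ, rfl⟩ := Hol.exists_eq_smul_one_of_derivHol_eq_zero hW hD
    exact ⟨γ, by rw [sub_self]; exact zero_mem _⟩
  | succ n =>
    refine ⟨0, ?_⟩
    rw [zero_smul, sub_zero, mem_polySpace_iff hW, pow_succ, Module.End.mul_apply]
    rw [mem_polySpace_iff hW] at hD hE
    rw [derivHol_pow_succ_coord_mul, hD, mul_zero, zero_add] at hE
    exact (smul_eq_zero.1 hE).resolve_left (Nat.cast_add_one_ne_zero n)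

theorem coord_pow_mul_derivHol_sub (n : ℕ) :
    coord W ^ n * derivHol W (coord W ^ (n + 1)) - coord W ^ (n + 1) * derivHol W (coord W ^ n) =
      coord W ^ (2 * n) := by
  cases n with
  | zero =>
    simp only [zero_add, pow_zero, pow_one, mul_zero, derivHol_coord, derivHol_one, mul_one,
      sub_zero]
  | succ n =>
    rw [derivHol_coord_pow, derivHol_coord_pow, mul_smul_comm, mul_smul_comm, ← pow_add, ← pow_add,
      Nat.add_sub_cancel, Nat.add_sub_cancel, show n + 1 + 1 + n = 2 * (n + 1) by ring,
      show n + 1 + (n + 1) = 2 * (n + 1) by ring, ← sub_smul, Nat.cast_succ (n + 1),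
      add_sub_cancel_left, one_smul]

theorem le_three_of_mul_derivHol_sub_mem_polySpace (hW : IsConnected (W : Set ℂ)) {d : ℕ}
    (h : ∀ f ∈ polySpace W d, ∀ g ∈ polySpace W d,
      f * derivHol W g - g * derivHol W f ∈ polySpace W d) : d ≤ 3 := by
  by_contra! hd
  obtain ⟨m, rfl⟩ := Nat.exists_eq_add_of_le' hd
  have h_mem := h _ (coord_pow_mem_polySpace (l := m + 2) (by lia)) _
    (coord_pow_mem_polySpace (l := m + 3) (by lia))
  rw [coord_pow_mul_derivHol_sub] at h_mem
  have h_lt := lt_of_coord_pow_mem_polySpace hW h_mem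
  lia

variable {M : Submodule ℂ (Coeff W)}

theorem isType2_of_verticalSpace_eq {ε α β γ : ℂ} {n : ℕ} (hε : ε = 0 ∨ ε = 1)
    (h1 : (1, 0, 0) ∈ M) (hz : (coord W, α • 1, β • 1) ∈ M)
    (hv : verticalSpace M =
      Submodule.span ℂ {(0, ε • 1, γ • 1)} ⊔ (polySpace W n).map (mulCoeff W))
    (hfst : M.map (LinearMap.fst ℂ _ _) ≤ polySpace W 2) : IsType2 (M.map (evenMap W)) := by
  have hT : ({(1, 0, 0), (coord W, α • 1, β • 1)} : Set (Coeff W)) ⊆ M := by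
    rintro _ (rfl | rfl)
    exacts [h1, hz]
  have h_span : polySpace W 2 ≤ Submodule.span ℂ
      (Prod.fst '' ({(1, 0, 0), (coord W, α • 1, β • 1)} : Set (Coeff W))) := by
    refine Submodule.span_mono ?_
    rintro _ ⟨l, rfl⟩
    rw [Set.image_pair]
    fin_cases l
    exacts [Or.inl (pow_zero _), Or.inr (pow_one _)]
  refine ⟨ε, α, β, γ, n, hε, ?_⟩
  rw [map_evenMap_eq_span hT (hfst.trans h_span) hv, Set.image_pair, evenMap_one_zero_zero,
    evenMap_smul_one, evenMap_zero_smul_one, ← Set.union_assoc, mulOp_smul, mulOp_smul, mulOp_one,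
    ← Set.range_comp, Set.insert_union, Set.singleton_union]
  congr 2
  exact Set.ext fun T => ⟨fun ⟨l, hl⟩ => ⟨l, l.2, hl.symm⟩, fun ⟨l, hl, h⟩ => ⟨⟨l, hl⟩, h.symm⟩⟩

theorem isType3_of_verticalSpace_eq {ε α β γ : ℂ} {n : ℕ} (hε : ε = 0 ∨ ε = 1) (hn : n ≤ 1)
    (h1 : (1, 0, 0) ∈ M) (hz : (coord W, α • 1, β • 1) ∈ M)
    (hz2 : (coord W ^ 2, (2 * α) • coord W, (2 * β) • coord W) ∈ M)
    (hv : verticalSpace M =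
      Submodule.span ℂ {(0, ε • 1, γ • 1)} ⊔ (polySpace W n).map (mulCoeff W))
    (hfst : M.map (LinearMap.fst ℂ _ _) ≤ polySpace W 3) : IsType3 (M.map (evenMap W)) := by
  have hT : ({(1, 0, 0), (coord W, α • 1, β • 1),
      (coord W ^ 2, (2 * α) • coord W, (2 * β) • coord W)} : Set (Coeff W)) ⊆ M := by
    rintro _ (rfl | rfl | rfl)
    exacts [h1, hz, hz2]
  have h_span : polySpace W 3 ≤ Submodule.span ℂ
      (Prod.fst '' ({(1, 0, 0), (coord W, α • 1, β • 1),
        (coord W ^ 2, (2 * α) • coord W, (2 * β) • coord W)} : Set (Coeff W))) := by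
    refine Submodule.span_mono ?_
    rintro _ ⟨l, rfl⟩
    rw [Set.image_insert_eq, Set.image_pair]
    fin_cases l
    exacts [Or.inl (pow_zero _), Or.inr (Or.inl (pow_one _)), Or.inr (Or.inr rfl)]
  have h_sq : evenMap W (coord W ^ 2, (2 * α) • coord W, (2 * β) • coord W) =
      mulOp (coord W ^ 2) * dz W + (2 * α) • (mulOp (coord W) * theta W * dtheta W) +
        (2 * β) • mulOp (coord W) := by
    rw [evenMap_apply, evenOp, mulOp_smul, mulOp_smul, smul_mul_assoc, smul_mul_assoc]
  refine ⟨ε, α, β, γ, n = 1, hε, ?_⟩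
  rw [map_evenMap_eq_span hT (hfst.trans h_span) hv, Set.image_insert_eq, Set.image_pair,
    evenMap_one_zero_zero, evenMap_smul_one, h_sq, evenMap_zero_smul_one, ← Set.union_assoc,
    mulOp_smul, mulOp_smul, mulOp_one, ← Set.range_comp]
  simp only [Set.insert_union, Set.singleton_union]
  congr 5
  ext T
  constructor
  · rintro ⟨l, rfl⟩
    obtain rfl : n = 1 := le_antisymm hn l.pos
    rw [Function.comp_apply, Fin.val_eq_zero, pow_zero]
    exact ⟨rfl, mulOp_one⟩
  · rintro ⟨rfl, rfl⟩
    exact ⟨0, mulOp_one⟩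

theorem IsAdmissible.exists_sub_smul_one_mem_functionSpace (hW : IsPreconnected (W : Set ℂ))
    (hM : IsAdmissible M) (h1 : (1, 0, 0) ∈ M) {g₁ h₁ : Hol W} (hz : (coord W, g₁, h₁) ∈ M) {n : ℕ}
    (hn : functionSpace M = polySpace W n) {g k : Hol W} (hk : (0, g, k) ∈ M) :
    ∃ γ : ℂ, k - γ • (1 : Hol W) ∈ functionSpace M := by
  rw [hn]
  exact exists_sub_smul_one_mem_polySpace hW (hn ▸ hM.derivHol_mem_functionSpace h1 hk)
    (hn ▸ hM.mul_derivHol_mem_functionSpace hz hk)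

theorem IsAdmissible.exists_map_fst_eq_polySpace (hW : IsConnected (W : Set ℂ))
    (hM : IsAdmissible M) (h1 : (1, 0, 0) ∈ M) {g h : Hol W} (hz : (coord W, g, h) ∈ M) :
    ∃ d ≤ 3, M.map (LinearMap.fst ℂ _ _) = polySpace W d := by
  have := hM.finiteDimensional
  have h_bracket : ∀ f₁ ∈ M.map (LinearMap.fst ℂ _ _), ∀ f₂ ∈ M.map (LinearMap.fst ℂ _ _),
      f₁ * derivHol W f₂ - f₂ * derivHol W f₁ ∈ M.map (LinearMap.fst ℂ _ _) := by
    rintro _ ⟨x, hx, rfl⟩ _ ⟨y, hy, rfl⟩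
    exact ⟨_, hM.bracket_mem x hx y hy, rfl⟩
  have h_deriv : ∀ f ∈ M.map (LinearMap.fst ℂ _ _), derivHol W f ∈ M.map (LinearMap.fst ℂ _ _) :=
    fun f hf => by
      have h_mem := h_bracket _ ⟨_, h1, rfl⟩ f hf
      rwa [LinearMap.fst_apply, derivHol_one, mul_zero, sub_zero, one_mul] at h_mem
  have h_euler : ∀ f ∈ M.map (LinearMap.fst ℂ _ _),
      coord W * derivHol W f ∈ M.map (LinearMap.fst ℂ _ _) := fun f hf => by
    have h_mem := add_mem (h_bracket _ ⟨_, hz, rfl⟩ f hf) hf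
    rwa [LinearMap.fst_apply, derivHol_coord, mul_one, sub_add_cancel] at h_mem
  have h_poly := eq_polySpace_of_euler hW.isPreconnected h_deriv h_euler
  refine ⟨_, le_three_of_mul_derivHol_sub_mem_polySpace hW ?_, h_poly⟩
  rwa [← h_poly]

theorem IsAdmissible.le_one_of_coord_sq_mem (hW : IsConnected (W : Set ℂ)) (hM : IsAdmissible M)
    {g h : Hol W} (hz2 : (coord W ^ 2, g, h) ∈ M) {n : ℕ}
    (hn : functionSpace M = polySpace W n) : n ≤ 1 := by
  by_contra! h_lt
  obtain ⟨m, rfl⟩ := Nat.exists_eq_add_of_le' h_lt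
  have h_mem : coord W ^ (m + 1) ∈ functionSpace M := hn ▸ coord_pow_mem_polySpace (by lia)
  have h_mul : coord W ^ 2 * derivHol W (coord W ^ (m + 1)) ∈ functionSpace M :=
    hM.mul_derivHol_mem_functionSpace hz2 h_mem
  rw [derivHol_coord_pow, mul_smul_comm, Nat.add_sub_cancel, ← pow_add, hn,
    Submodule.smul_mem_iff _ (Nat.cast_ne_zero.2 m.succ_ne_zero)] at h_mul
  have h_lt := lt_of_coord_pow_mem_polySpace hW h_mul
  lia

theorem IsAdmissible.exists_coord_mem_and_coord_sq_mem (hW : IsPreconnected (W : Set ℂ))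
    (hM : IsAdmissible M) (h1 : (1, 0, 0) ∈ M) {α β : ℂ} (hz : (coord W, α • 1, β • 1) ∈ M)
    {n : ℕ} (hn : functionSpace M = polySpace W n) (hn1 : n ≤ 1) {g h : Hol W}
    (hz2 : (coord W ^ 2, g, h) ∈ M) :
    ∃ α' β' : ℂ, (coord W, α' • 1, β' • 1) ∈ M ∧
      (coord W ^ 2, (2 * α') • coord W, (2 * β') • coord W) ∈ M := by
  -- Half the bracket of `∂_z` and `z²∂_z + g θ∂_θ + h` is the new `z∂_z + α' θ∂_θ + β'`.
  have h_deriv : ((2 : ℂ) • coord W, derivHol W g, derivHol W h) ∈ M := by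
    simpa only [bracket, derivHol_one, derivHol_coord_pow, map_zero, mul_zero, sub_zero, one_mul,
      pow_one, Nat.add_one_sub_one, Nat.cast_ofNat] using hM.bracket_mem _ h1 _ hz2
  have h_vert : (0, derivHol W g - (2 * α) • 1, derivHol W h - (2 * β) • 1) ∈ M := by
    simpa only [Prod.smul_mk, Prod.mk_sub_mk, sub_self, smul_smul] using
      M.sub_mem h_deriv (M.smul_mem 2 hz)
  obtain ⟨a, ha⟩ := hM.exists_eq_smul_one _ _ h_vert
  obtain ⟨γ, hγ⟩ := hM.exists_sub_smul_one_mem_functionSpace hW h1 hz hn h_vert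
  obtain ⟨b, hb⟩ := Submodule.mem_span_singleton.1 (polySpace_one ▸ polySpace_mono hn1 (hn ▸ hγ))
  have hg : derivHol W g = (2 * (α + a / 2)) • (1 : Hol W) := by
    rw [sub_eq_iff_eq_add.1 ha]
    module
  have hh : derivHol W h = (2 * (β + (γ + b) / 2)) • (1 : Hol W) := by
    rw [sub_eq_iff_eq_add.1 (sub_eq_iff_eq_add.1 hb.symm)]
    module
  have hz' : (coord W, (α + a / 2) • 1, (β + (γ + b) / 2) • 1) ∈ M := by
    simpa only [hg, hh, Prod.smul_mk, smul_smul, inv_mul_cancel_left₀, inv_mul_cancel₀, ne_eq,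
      OfNat.ofNat_ne_zero, not_false_eq_true, one_smul] using M.smul_mem 2⁻¹ h_deriv
  refine ⟨_, _, hz', ?_⟩
  have h_sq : (2 : ℂ) • (coord W * coord W) - coord W ^ 2 = coord W ^ 2 := by
    rw [← sq, two_smul, add_sub_cancel_right]
  simpa only [bracket, hg, hh, map_smul, derivHol_one, smul_zero, derivHol_coord,
    derivHol_coord_pow, mul_zero, sub_zero, mul_one, mul_smul_comm, pow_one, Nat.add_one_sub_one,
    Nat.cast_ofNat, h_sq] using hM.bracket_mem _ hz' _ hz2

theorem IsAdmissible.isType2_or_isType3 (hW : IsConnected (W : Set ℂ)) (hM : IsAdmissible M)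
    (h1 : (1, 0, 0) ∈ M) {α β : ℂ} (hz : (coord W, α • 1, β • 1) ∈ M) :
    IsType2 (M.map (evenMap W)) ∨ IsType3 (M.map (evenMap W)) := by
  have := hM.finiteDimensional_functionSpace
  obtain ⟨ε, h₁, hε, -, h_gen, hv⟩ := hM.exists_generator
  have hn := eq_polySpace_of_euler hW.isPreconnected (P := functionSpace M)
    (fun k hk => hM.derivHol_mem_functionSpace h1 hk)
    (fun k hk => hM.mul_derivHol_mem_functionSpace hz hk)
  obtain ⟨γ, hγ⟩ :=
    hM.exists_sub_smul_one_mem_functionSpace hW.isPreconnected h1 hz hn h_gen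
  have hv' := verticalSpace_eq_of_sub_mem hv hγ
  rw [hn] at hv'
  obtain ⟨d, hd, h_fst⟩ := hM.exists_map_fst_eq_polySpace hW h1 hz
  rcases hd.lt_or_eq with hd | rfl
  · exact Or.inl (isType2_of_verticalSpace_eq hε h1 hz hv'
      (h_fst.le.trans (polySpace_mono (Nat.lt_succ_iff.1 hd))))
  · obtain ⟨⟨_, g, h⟩, hz2, rfl⟩ : coord W ^ 2 ∈ M.map (LinearMap.fst ℂ _ _) :=
      h_fst ▸ coord_pow_mem_polySpace (by lia)
    have hn1 := hM.le_one_of_coord_sq_mem hW hz2 hn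
    obtain ⟨α', β', hz', hz2'⟩ :=
      hM.exists_coord_mem_and_coord_sq_mem hW.isPreconnected h1 hz hn hn1 hz2
    exact Or.inr (isType3_of_verticalSpace_eq hε hn1 h1 hz' hz2' hv' h_fst.le)

end PolynomialForms

/-! ### Regular points -/

section Regular

variable {U : Opens ℂ}

theorem setOf_isRegularPoint_mem_codiscreteWithin (hU : IsPreconnected (U : Set ℂ))
    (L : Submodule ℂ (Op U)) :
    {z : ℂ | ∃ hz : z ∈ U, IsRegularPoint L ⟨z, hz⟩} ∈ Filter.codiscreteWithin (U : Set ℂ) := by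
  have h_self := Filter.self_mem_codiscreteWithin (U : Set ℂ)
  by_cases h0 : ∀ f g h : Hol U, evenOp f g h ∈ L → f = 0
  · filter_upwards [h_self] with z hz using ⟨hz, Or.inl h0⟩
  · push Not at h0
    obtain ⟨f, g, h, h_mem, hf⟩ := h0
    rcases (analyticOnNhd_extendZero f).eqOn_zero_or_eventually_ne_zero_of_preconnected hU
      with h_zero | h_ne
    · exact absurd (Hol.ext fun z => (extendZero_apply ⇑f z).symm.trans (h_zero z.2)) hf
    · filter_upwards [h_self, h_ne] with z hz hfz
      exact ⟨hz, Or.inr ⟨f, g, h, h_mem, (extendZero_apply ⇑f ⟨z, hz⟩).symm.trans_ne hfz⟩⟩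

theorem restrictOps_le_refl_map_evenMap (M : Submodule ℂ (Coeff U)) :
    restrictOps (le_refl U) (M.map (evenMap U)) = M.map (evenMap U) := by
  rw [restrictOps_map_evenMap, show resCoeff (le_refl U) = LinearMap.id from rfl, Submodule.map_id]

end Regular

end

end SuperDiff

theorem mainTheorem4 (U : TopologicalSpace.Opens ℂ) (hU : IsConnected (U : Set ℂ))
    (s : Submodule ℂ (SuperDiff.Op U)) (hs : SuperDiff.IsGradedSubalgebra s)
    (hfin : FiniteDimensional ℂ s) (hodd : SuperDiff.oddPart s ≠ ⊥) :
    {z : ℂ | ∃ hz : z ∈ U, SuperDiff.IsRegularPoint (SuperDiff.evenPart s) ⟨z, hz⟩} ∈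
        Filter.codiscreteWithin (U : Set ℂ) ∧
      ∀ z₀ : U, SuperDiff.IsRegularPoint (SuperDiff.evenPart s) z₀ →
        ∃ (V : TopologicalSpace.Opens ℂ) (hVU : V ≤ U), (z₀ : ℂ) ∈ V ∧
          ∃ (W : TopologicalSpace.Opens ℂ) (L : Submodule ℂ (SuperDiff.Op W)),
            SuperDiff.Equivalent (SuperDiff.restrictOps hVU (SuperDiff.evenPart s)) L ∧
              (SuperDiff.IsType0 L ∨ SuperDiff.IsType1 L ∨ SuperDiff.IsType2 L ∨
                SuperDiff.IsType3 L) := by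
  refine ⟨SuperDiff.setOf_isRegularPoint_mem_codiscreteWithin hU.isPreconnected _,
    fun z₀ hz₀ => ?_⟩
  have hM := SuperDiff.isAdmissible_coeffSpace hU.isPreconnected hs hodd
  rcases hz₀ with h0 | ⟨f, g, h, h_mem, hfz⟩
  · refine ⟨U, le_rfl, z₀.2, U, _, SuperDiff.Equivalent.refl _, Or.inl ?_⟩
    rw [SuperDiff.evenPart_eq_map, SuperDiff.restrictOps_le_refl_map_evenMap]
    exact hM.isType0 fun x hx => h0 _ _ _ (SuperDiff.evenOp_mem_evenPart_iff.2 hx)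
  · obtain ⟨V, hVU, W, r, N, hzV, hr, hW, hN, h_equiv, h1, h_cases⟩ :=
      hM.rectify hU.isPreconnected (SuperDiff.evenOp_mem_evenPart_iff.1 h_mem) hfz
    have hW' : IsConnected (W : Set ℂ) :=
      hW ▸ (convex_ball (0 : ℂ) r).isConnected (Metric.nonempty_ball.2 hr)
    refine ⟨V, hVU, hzV, W, _, SuperDiff.evenPart_eq_map s ▸ h_equiv, Or.inr ?_⟩
    rcases h_cases with h_one | ⟨α, β, hz⟩
    · exact Or.inl (hN.isType1 hW'.isPreconnected h1 h_one)
    · exact Or.inr (hN.isType2_or_isType3 hW' h1 hz)
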